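/- A bumpless pipe dream (BPD) of size $n$ is a filling $B$ of the cells $(i,j)$ of an $n\times n$ grid (rows numbered from the top, columns from the left) by six tiles --- blank, horizontal, vertical, cross, r-elbow (joining south and east) and j-elbow (joining west and north) --- such that the strands match up along shared edges and form $n$ pipes, each running from the south side of the grid to its east side; every edge of the south and east sides is used, and none of the north and west sides. Write $y\to x$ for a pipe that enters in column $y$ and exits in row $x$. The permutation $w$ of $B$ is given by the pipes $w(x)\to x$. $B$ is reduced if any two different pipes cross at most once. A pipe $y\to x$ is removable if $B_{x,y}$ is an r-elbow which is the only r-elbow in row $x$ and the only one in column $y$; $B$ is minimal if it has no removable pipes. Let $w\in S_n$, let $v=w(s_1)\cdots w(s_m)$ $(s_1<\dots<s_m)$ be a subword of $w$, let $t_1<\dots<t_m$ be the entries of $v$ in increasing order, and let $u=\operatorname{perm}(v)\in S_m$ be the standardization of $v$, so that $t_{u(i)}=w(s_i)$. Let $\operatorname{bpd}(w;v)$ be the set of reduced BPDs with permutation $w$ whose removable pipes are exactly the pipes $w(x)\to x$ with $x\notin\{s_1,\dots,s_m\}$, and let $\operatorname{mbpd}(u)$ be the set of minimal reduced BPDs with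 permutation $u$. Let $\varphi_v^w(B)$ be the $m\times m$ filling obtained from $B$ by erasing the pipes $w(x)\to x$ with $x\notin\{s_1,\dots,s_m\}$ and then deleting all rows other than $s_1,\dots,s_m$ and all columns other than $t_1,\dots,t_m$. For a reduced BPD $B$ whose permutation has length $\ell$, let $$\operatorname{wt}^{(\beta)}(B)=\beta^{\#\mathrm{blanks}(B)-\ell}\,(1+\beta)^{\#\text{j-elbows}(B)},$$ and for a finite set $S$ of reduced BPDs let $\operatorname{wt}^{(\beta)}(S)=\sum_{B\in S}\operatorname{wt}^{(\beta)}(B)$. Here $\beta$ is any element of a commutative ring (for instance the variable of $\mathbb Z[\beta]$). **Proposition.** (1) For every $B\in\operatorname{bpd}(w;v)$ one has $\varphi_v^w(B)\in\operatorname{mbpd}(u)$ and $$\operatorname{wt}^{(\beta)}(B)=(1+\beta)^{\#\text{j-elbows}(B)}=(1+\beta)^{\#\text{j-elbows}(\varphi_v^w(B))}=\operatorname{wt}^{(\beta)}(\varphi_v^w(B)).$$ (2) If $w$ avoids the pattern $1243$, then $\operatorname{wt}^{(\beta)}(\operatorname{bpd}(w;v))=\operatorname{wt}^{(\beta)}(\operatorname{mbpd}(u))$.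 -/

import Mathlib

namespace BumplessPipeDream

/-- The six tiles of a bumpless pipe dream. `relbow` joins the south and the east edge of the cell,
`jelbow` joins its west and north edge. -/
inductive Tile where
  | blank | horizontal | vertical | cross | relbow | jelbow
  deriving DecidableEq

instance : Fintype Tile where
  elems := {.blank, .horizontal, .vertical, .cross, .relbow, .jelbow}
  complete t := by cases t <;> decide

/-- A pipe is traversed from south to east; it enters each cell that it visits either from the south
(travelling north) or from the west (travelling east). -/
inductive Dir where
  | north | east

/-- The tile has a strand that meets the north edge of its cell. -/
def Tile.hasN (t : Tile) : Prop := t = .vertical ∨ t = .cross ∨ t = .jelbow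

/-- The tile has a strand that meets the south edge of its cell. -/
def Tile.hasS (t : Tile) : Prop := t = .vertical ∨ t = .cross ∨ t = .relbow

/-- The tile has a strand that meets the east edge of its cell. -/
def Tile.hasE (t : Tile) : Prop := t = .horizontal ∨ t = .cross ∨ t = .relbow

/-- The tile has a strand that meets the west edge of its cell. -/
def Tile.hasW (t : Tile) : Prop := t = .horizontal ∨ t = .cross ∨ t = .jelbow

/-- A filling of the `n × n` grid by tiles. `B i j` is the tile in row `i` (counted from the top)
and column `j` (counted from the left). -/
abbrev Tiling (n : ℕ) := Fin n → Fin n → Tile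

variable {n m : ℕ}

/-- A bumpless pipe dream of size `n`: strands of adjacent tiles match up, no strand touches the
north or the west side of the grid, and a strand meets every edge of its south and east sides. -/
structure IsBPD (B : Tiling n) : Prop where
  horiz : ∀ i j j' : Fin n, j'.val = j.val + 1 → ((B i j).hasE ↔ (B i j').hasW)
  vert : ∀ i i' j : Fin n, i'.val = i.val + 1 → ((B i j).hasS ↔ (B i' j).hasN)
  west : ∀ i j : Fin n, j.val = 0 → ¬ (B i j).hasW
  north : ∀ i j : Fin n, i.val = 0 → ¬ (B i j).hasN
  east : ∀ i j : Fin n, j.val + 1 = n → (B i j).hasE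
  south : ∀ i j : Fin n, i.val + 1 = n → (B i j).hasS

/-- `Enters B y i j d`: the pipe of `B` that starts at the south side of the grid in column `y`
enters the cell `(i, j)`, travelling in direction `d`. Two pipes that meet in a `cross` tile
cross each other there. -/
inductive Enters (B : Tiling n) (y : Fin n) : Fin n → Fin n → Dir → Prop
  | start (i : Fin n) (hi : i.val + 1 = n) : Enters B y i y .north
  | straightNorth (i i' j : Fin n) (h : Enters B y i j .north)
      (ht : B i j = .vertical ∨ B i j = .cross) (hi : i'.val + 1 = i.val) :
      Enters B y i' j .north
  | turnEast (i j j' : Fin n) (h : Enters B y i j .north)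
      (ht : B i j = .relbow) (hj : j'.val = j.val + 1) : Enters B y i j' .east
  | straightEast (i j j' : Fin n) (h : Enters B y i j .east)
      (ht : B i j = .horizontal ∨ B i j = .cross) (hj : j'.val = j.val + 1) :
      Enters B y i j' .east
  | turnNorth (i i' j : Fin n) (h : Enters B y i j .east)
      (ht : B i j = .jelbow) (hi : i'.val + 1 = i.val) : Enters B y i' j .north

/-- `y → x` is a pipe of `B`: the pipe that enters the grid from the south in column `y` leaves the
grid to the east in row `x`. -/
def IsPipe (B : Tiling n) (y x : Fin n) : Prop :=
  ∃ j : Fin n, j.val + 1 = n ∧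
    ((Enters B y x j .north ∧ B x j = .relbow) ∨
      (Enters B y x j .east ∧ (B x j = .horizontal ∨ B x j = .cross)))

/-- The pipes of `B` starting in columns `y` and `y'` cross in the cell `(i, j)`. -/
def CrossAt (B : Tiling n) (y y' i j : Fin n) : Prop :=
  B i j = .cross ∧
    ((Enters B y i j .north ∧ Enters B y' i j .east) ∨
      (Enters B y i j .east ∧ Enters B y' i j .north))

/-- Any two different pipes of `B` cross at most once. -/
def Reduced (B : Tiling n) : Prop :=
  ∀ y y' : Fin n, y ≠ y' → ∀ i j i' j' : Fin n,
    CrossAt B y y' i j → CrossAt B y y' i' j' → i = i' ∧ j = j'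

/-- The pipe `y → x` of `B` is removable: it has an r-elbow at `(x, y)`, and that is the only
r-elbow of `B` in row `x` and the only one in column `y`. -/
def Removable (B : Tiling n) (y x : Fin n) : Prop :=
  IsPipe B y x ∧ B x y = .relbow ∧
    (∀ j, B x j = .relbow → j = y) ∧ (∀ i, B i y = .relbow → i = x)

/-- `B` has no removable pipes. -/
def Minimal (B : Tiling n) : Prop := ∀ y x, ¬ Removable B y x

/-- `B` is a bumpless pipe dream with permutation `w`, i.e. its pipes are `w x → x`. -/
def HasPerm (w : Equiv.Perm (Fin n)) (B : Tiling n) : Prop :=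
  IsBPD B ∧ ∀ x, IsPipe B (w x) x

/-! A subword `v` of size `m` of `w = w(1) ⋯ w(n)` is given by its indices `s₁ < ⋯ < s_m` in `w`,
as an order embedding `s : Fin m ↪o Fin n`; then `v(i) = w(sᵢ)`. -/

/-- The set of entries of the subword of `w` with indices `s`. -/
def entries (w : Equiv.Perm (Fin n)) (s : Fin m ↪o Fin n) : Finset (Fin n) :=
  Finset.univ.map (s.toEmbedding.trans w.toEmbedding)

theorem card_entries (w : Equiv.Perm (Fin n)) (s : Fin m ↪o Fin n) : (entries w s).card = m := by
  simp [entries]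

theorem mem_entries (w : Equiv.Perm (Fin n)) (s : Fin m ↪o Fin n) (i : Fin m) :
    w (s i) ∈ entries w s := by
  simp [entries]

/-- The entries `t₁ < ⋯ < t_m` of the subword in increasing order. -/
def sortedEntries (w : Equiv.Perm (Fin n)) (s : Fin m ↪o Fin n) : Fin m ↪o Fin n :=
  (entries w s).orderEmbOfFin (card_entries w s)

/-- The position of `v(i)` among the sorted entries of `v`. -/
def relRank (w : Equiv.Perm (Fin n)) (s : Fin m ↪o Fin n) (i : Fin m) : Fin m :=
  ((entries w s).orderIsoOfFin (card_entries w s)).symm ⟨w (s i), mem_entries w s i⟩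

theorem sortedEntries_relRank (w : Equiv.Perm (Fin n)) (s : Fin m ↪o Fin n) (i : Fin m) :
    sortedEntries w s (relRank w s i) = w (s i) := by
  simp [sortedEntries, relRank, Finset.orderEmbOfFin]

theorem relRank_injective (w : Equiv.Perm (Fin n)) (s : Fin m ↪o Fin n) :
    Function.Injective (relRank w s) := by
  intro i j h
  have h2 := congrArg (sortedEntries w s) h
  rw [sortedEntries_relRank, sortedEntries_relRank] at h2
  exact s.injective (w.injective h2)

/-- The standardization `perm(v)` of the subword: the permutation `u` of `{1, …, m}` whose entries
are in the same relative order as those of `v`. -/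
noncomputable def stdPerm (w : Equiv.Perm (Fin n)) (s : Fin m ↪o Fin n) : Equiv.Perm (Fin m) :=
  Equiv.ofBijective (relRank w s) (Finite.injective_iff_bijective.mp (relRank_injective w s))

open Classical in
/-- Erase from `B` the pipes that start in the columns belonging to `Y`. -/
noncomputable def erase (B : Tiling n) (Y : Set (Fin n)) : Tiling n := fun i j =>
  match B i j with
  | .cross =>
    if ∃ y ∈ Y, Enters B y i j .north then
      if ∃ y ∈ Y, Enters B y i j .east then .blank else .horizontal
    else
      if ∃ y ∈ Y, Enters B y i j .east then .vertical else .cross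
  | t => if ∃ y ∈ Y, ∃ d, Enters B y i j d then .blank else t

/-- The pipe removal map: erase the pipes `y → x` with `y` not an entry of the subword `v`, then
delete the rows not indexed by `s₁ < ⋯ < s_m` and the columns not indexed by `t₁ < ⋯ < t_m`. -/
noncomputable def phi (w : Equiv.Perm (Fin n)) (s : Fin m ↪o Fin n) (B : Tiling n) : Tiling m :=
  fun i j => erase B {y | y ∉ entries w s} (s i) (sortedEntries w s j)

open Classical in
/-- `bpd(w; v)`: the reduced bumpless pipe dreams with permutation `w` whose removable pipes are
exactly the pipes `w x → x` with `w x` not in the subword `v`. -/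
noncomputable def bpdSub (w : Equiv.Perm (Fin n)) (s : Fin m ↪o Fin n) : Finset (Tiling n) :=
  Finset.univ.filter fun B =>
    HasPerm w B ∧ Reduced B ∧ ∀ x, Removable B (w x) x ↔ x ∉ Set.range s

open Classical in
/-- `mbpd(u)`: the minimal reduced bumpless pipe dreams with permutation `u`. -/
noncomputable def mbpd (u : Equiv.Perm (Fin m)) : Finset (Tiling m) :=
  Finset.univ.filter fun B => HasPerm u B ∧ Reduced B ∧ Minimal B

/-- The number of tiles of `B` equal to `t`. -/
def numTile (t : Tile) (B : Tiling n) : ℕ :=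
  (Finset.univ.filter fun p : Fin n × Fin n => B p.1 p.2 = t).card

open Classical in
/-- The length of the permutation of `B`: the number of pairs of pipes `y → x`, `y' → x'` with
`x < x'` and `y > y'`. -/
noncomputable def permLength (B : Tiling n) : ℕ :=
  (Finset.univ.filter fun p : Fin n × Fin n =>
    p.1 < p.2 ∧ ∃ y y', y' < y ∧ IsPipe B y p.1 ∧ IsPipe B y' p.2).card

/-- The `β`-weight `β ^ (#blank - ℓ) * (1 + β) ^ #jelbow` of a reduced bumpless pipe dream, `ℓ` being
the length of its permutation (for a reduced `B`, the permutation and the type of `B` agree). -/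
noncomputable def wt {R : Type*} [CommRing R] (β : R) (B : Tiling n) : R :=
  β ^ (numTile .blank B - permLength B) * (1 + β) ^ numTile .jelbow B

/-- The `β`-weight of a finite set of reduced bumpless pipe dreams. -/
noncomputable def wtSum {R : Type*} [CommRing R] (β : R) (S : Finset (Tiling n)) : R :=
  ∑ B ∈ S, wt β B

/-- `w` avoids the pattern `1243`. -/
def Avoids1243 (w : Equiv.Perm (Fin n)) : Prop :=
  ¬ ∃ a b c d : Fin n, a < b ∧ b < c ∧ c < d ∧ w a < w b ∧ w b < w d ∧ w d < w c

end BumplessPipeDream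

/-! A removable pipe `w x → x` is a hook: it runs straight up column `w x`, turns once at `(x, w
x)`, and runs straight out along row `x`. Since that cell is the only r-elbow of its row and of its
column, no strand can begin before it and none can end after it, so every other cell of the row and
of the column is straight. Straight cells merely pass edges on. Hence deleting the rows and columns
of hooks (`Hooked.isBPD_submatrix`) leaves a bumpless pipe dream whose pipes follow the old ones,
with the same j-elbows, the same crossings among the kept pipes and the same remaining hooks; and
`phi` is exactly this submatrix.

The weight needs no comparison of blanks. Counting used edges shows that every bumpless pipe dream
has as many blanks as crosses (`IsBPD.numTile_blank`), and in a reduced one the crosses inject into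
the inversions (`HasPerm.numTile_cross_le`). So the exponent of `β` vanishes and only the j-elbows
count.

For the second part `phi` is a bijection. The edges of a hooked filling are forced by its submatrix,
which gives injectivity (`Hooked.eq_of_submatrix_eq`). Conversely hooks can always be inserted
(`insertHooks`), and only reducedness may fail, when a pipe meets both arms of a hook. Such a pipe
starts to the left of the hook and ends above it, so it needs a j-elbow strictly south-east of the
corner. An extremal such j-elbow yields two further pipes, inverted and south-east of the hook; the
four pipes form a `1243` pattern. -/

namespace BumplessPipeDream

variable {n m : ℕ}

/-! ### Pipes as lattice paths -/

/-- The edge through which a pipe travelling in direction `d` enters a cell with tile `t` is used. -/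
def Tile.entered (t : Tile) : Dir → Prop
  | .north => t.hasS
  | .east => t.hasW

/-- The tile does not bend any pipe. -/
def Tile.Straight (t : Tile) : Prop := t ≠ .relbow ∧ t ≠ .jelbow

theorem Tile.Straight.hasE_iff {t : Tile} (h : t.Straight) : t.hasE ↔ t.hasW := by
  cases t <;> simp_all [Tile.Straight, hasE, hasW]

theorem Tile.Straight.north {t : Tile} (h : t.Straight) (hS : t.hasS) :
    t = .vertical ∨ t = .cross := by
  cases t <;> simp_all [Tile.Straight, hasS]

theorem Tile.Straight.east {t : Tile} (h : t.Straight) (hW : t.hasW) :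
    t = .horizontal ∨ t = .cross := by
  cases t <;> simp_all [Tile.Straight, hasW]

theorem Tile.ext_edges {t t' : Tile} (hN : t.hasN ↔ t'.hasN) (hS : t.hasS ↔ t'.hasS)
    (hE : t.hasE ↔ t'.hasE) (hW : t.hasW ↔ t'.hasW) : t = t' := by
  cases t <;> cases t' <;> simp_all [hasN, hasS, hasE, hasW]

theorem Enters.entered {B : Tiling n} (hB : IsBPD B) {y i j : Fin n} {d : Dir}
    (h : Enters B y i j d) : (B i j).entered d := by
  cases h with
  | start _ hi => exact hB.south _ _ hi
  | straightNorth i' _ _ h ht hi =>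
    refine (hB.vert _ i' _ hi.symm).2 ?_
    rcases ht with ht | ht <;> simp [ht, Tile.hasN]
  | turnEast _ j _ h ht hj =>
    refine (hB.horiz _ j _ hj).1 ?_
    simp [ht, Tile.hasE]
  | straightEast _ j _ h ht hj =>
    refine (hB.horiz _ j _ hj).1 ?_
    rcases ht with ht | ht <;> simp [ht, Tile.hasE]
  | turnNorth i' _ _ h ht hi =>
    refine (hB.vert _ i' _ hi.symm).2 ?_
    simp [ht, Tile.hasN]

theorem Enters.col_le {B : Tiling n} {y i j : Fin n} {d : Dir} (h : Enters B y i j d) :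
    y ≤ j ∧ (d = .east → y < j) := by
  induction h with
  | start => simp
  | straightNorth i i' j h ht hi ih => exact ⟨ih.1, by simp⟩
  | turnEast i j j' h ht hj ih => exact ⟨by omega, fun _ => by omega⟩
  | straightEast i j j' h ht hj ih => exact ⟨by omega, fun _ => by omega⟩
  | turnNorth i i' j h ht hi ih => exact ⟨ih.1, by simp⟩

/-- At most one pipe enters a cell in a given direction. -/
theorem Enters.unique {B : Tiling n} {y y' i j : Fin n} {d : Dir} (h : Enters B y i j d)
    (h' : Enters B y' i j d) : y = y' := by
  induction h with
  | start i hi =>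
    cases h' with
    | start => rfl
    | straightNorth i' _ _ h ht hi' => omega
    | turnNorth i' _ _ h ht hi' => omega
  | straightNorth i i' j h ht hi ih =>
    cases h' with
    | start => omega
    | straightNorth k _ _ h ht hi' => obtain rfl : i = k := Fin.ext (by omega); exact ih h
    | turnNorth k _ _ h ht' hi' => obtain rfl : i = k := Fin.ext (by omega); simp [ht'] at ht
  | turnEast i j j' h ht hj ih =>
    cases h' with
    | turnEast _ k _ h ht' hj' => obtain rfl : j = k := Fin.ext (by omega); exact ih h
    | straightEast _ k _ h ht' hj' => obtain rfl : j = k := Fin.ext (by omega); simp [ht] at ht'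
  | straightEast i j j' h ht hj ih =>
    cases h' with
    | turnEast _ k _ h ht' hj' => obtain rfl : j = k := Fin.ext (by omega); simp [ht'] at ht
    | straightEast _ k _ h ht' hj' => obtain rfl : j = k := Fin.ext (by omega); exact ih h
  | turnNorth i i' j h ht hi ih =>
    cases h' with
    | start => omega
    | straightNorth k _ _ h ht' hi' => obtain rfl : i = k := Fin.ext (by omega); simp [ht] at ht'
    | turnNorth k _ _ h ht' hi' => obtain rfl : i = k := Fin.ext (by omega); exact ih h

theorem IsPipe.unique {B : Tiling n} {y y' x : Fin n} (h : IsPipe B y x) (h' : IsPipe B y' x) :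
    y = y' := by
  obtain ⟨j, hj, h⟩ := h
  obtain ⟨j', hj', h'⟩ := h'
  obtain rfl : j = j' := Fin.ext (by omega)
  rcases h with ⟨h, ht⟩ | ⟨h, ht⟩ <;> rcases h' with ⟨h', ht'⟩ | ⟨h', ht'⟩
  · exact h.unique h'
  · simp [ht] at ht'
  · simp [ht'] at ht
  · exact h.unique h'

theorem HasPerm.eq_of_isPipe {w : Equiv.Perm (Fin n)} {B : Tiling n} (hB : HasPerm w B)
    {y x : Fin n} (h : IsPipe B y x) : y = w x := h.unique (hB.2 x)

/-- Every used edge is entered by a pipe. -/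
theorem IsBPD.exists_enters {B : Tiling n} (hB : IsBPD B) (i j : Fin n) (d : Dir)
    (h : (B i j).entered d) : ∃ y, Enters B y i j d := by
  -- Each step backwards along a pipe goes down or left, so this measure drops by one.
  induction hk : n - i.val + j.val using Nat.strong_induction_on generalizing i j d with
  | _ k ih =>
  cases d with
  | north =>
    by_cases hi : i.val + 1 = n
    · exact ⟨j, .start i hi⟩
    · obtain ⟨i', hi'⟩ : ∃ i' : Fin n, i'.val = i.val + 1 := ⟨⟨i.val + 1, by omega⟩, rfl⟩
      have hN := (hB.vert i i' j hi').1 h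
      have hlt : n - i'.val + j.val < k := by omega
      rcases hN with ht | ht | ht
      · obtain ⟨y, hy⟩ := ih _ hlt i' j .north (by simp [Tile.entered, Tile.hasS, ht]) rfl
        exact ⟨y, .straightNorth _ _ _ hy (Or.inl ht) hi'.symm⟩
      · obtain ⟨y, hy⟩ := ih _ hlt i' j .north (by simp [Tile.entered, Tile.hasS, ht]) rfl
        exact ⟨y, .straightNorth _ _ _ hy (Or.inr ht) hi'.symm⟩
      · obtain ⟨y, hy⟩ := ih _ hlt i' j .east (by simp [Tile.entered, Tile.hasW, ht]) rfl
        exact ⟨y, .turnNorth _ _ _ hy ht hi'.symm⟩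
  | east =>
    by_cases hj : j.val = 0
    · exact absurd h (hB.west i j hj)
    · obtain ⟨j', hj'⟩ : ∃ j' : Fin n, j.val = j'.val + 1 :=
        ⟨⟨j.val - 1, by omega⟩, by simp; omega⟩
      have hE := (hB.horiz i j' j hj').2 h
      have hlt : n - i.val + j'.val < k := by omega
      rcases hE with ht | ht | ht
      · obtain ⟨y, hy⟩ := ih _ hlt i j' .east (by simp [Tile.entered, Tile.hasW, ht]) rfl
        exact ⟨y, .straightEast _ _ _ hy (Or.inl ht) hj'⟩
      · obtain ⟨y, hy⟩ := ih _ hlt i j' .east (by simp [Tile.entered, Tile.hasW, ht]) rfl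
        exact ⟨y, .straightEast _ _ _ hy (Or.inr ht) hj'⟩
      · obtain ⟨y, hy⟩ := ih _ hlt i j' .north (by simp [Tile.entered, Tile.hasS, ht]) rfl
        exact ⟨y, .turnEast _ _ _ hy ht hj'⟩

theorem IsBPD.exists_isPipe {B : Tiling n} (hB : IsBPD B) (x : Fin n) : ∃ y, IsPipe B y x := by
  have hn := x.isLt
  obtain ⟨j, hj⟩ : ∃ j : Fin n, j.val + 1 = n := ⟨⟨n - 1, by omega⟩, by simp; omega⟩
  rcases hB.east x j hj with ht | ht | ht
  · obtain ⟨y, hy⟩ := hB.exists_enters x j .east (by simp [Tile.entered, Tile.hasW, ht])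
    exact ⟨y, j, hj, Or.inr ⟨hy, Or.inl ht⟩⟩
  · obtain ⟨y, hy⟩ := hB.exists_enters x j .east (by simp [Tile.entered, Tile.hasW, ht])
    exact ⟨y, j, hj, Or.inr ⟨hy, Or.inr ht⟩⟩
  · obtain ⟨y, hy⟩ := hB.exists_enters x j .north (by simp [Tile.entered, Tile.hasS, ht])
    exact ⟨y, j, hj, Or.inl ⟨hy, ht⟩⟩

/-- What a pipe does after entering a cell: it goes on to the cell above, or it goes on to the cell
to the right, or it leaves the grid. -/
inductive Next (B : Tiling n) (y i j : Fin n) (d : Dir) : Prop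
  | north (i' : Fin n) (hi : i'.val + 1 = i.val) (h : Enters B y i' j .north)
      (ht : (d = .north ∧ (B i j = .vertical ∨ B i j = .cross)) ∨ (d = .east ∧ B i j = .jelbow))
  | east (j' : Fin n) (hj : j'.val = j.val + 1) (h : Enters B y i j' .east)
      (ht : (d = .north ∧ B i j = .relbow) ∨
        (d = .east ∧ (B i j = .horizontal ∨ B i j = .cross)))
  | exit (hj : j.val + 1 = n) (h : IsPipe B y i)
      (ht : (d = .north ∧ B i j = .relbow) ∨
        (d = .east ∧ (B i j = .horizontal ∨ B i j = .cross)))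

theorem Enters.next {B : Tiling n} (hB : IsBPD B) {y i j : Fin n} {d : Dir}
    (h : Enters B y i j d) : Next B y i j d := by
  have he := h.entered hB
  have up : (B i j).hasN → ∃ i' : Fin n, i'.val + 1 = i.val := by
    intro hN
    have : i.val ≠ 0 := fun h0 => hB.north i j h0 hN
    exact ⟨⟨i.val - 1, by omega⟩, by simp; omega⟩
  have right : j.val + 1 = n ∨ ∃ j' : Fin n, j'.val = j.val + 1 := by
    by_cases hj : j.val + 1 = n
    · exact Or.inl hj
    · exact Or.inr ⟨⟨j.val + 1, by omega⟩, rfl⟩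
  cases d with
  | north =>
    rcases he with ht | ht | ht
    · obtain ⟨i', hi⟩ := up (by simp [Tile.hasN, ht])
      exact .north i' hi (.straightNorth _ _ _ h (Or.inl ht) hi) (by simp [ht])
    · obtain ⟨i', hi⟩ := up (by simp [Tile.hasN, ht])
      exact .north i' hi (.straightNorth _ _ _ h (Or.inr ht) hi) (by simp [ht])
    · rcases right with hj | ⟨j', hj⟩
      · exact .exit hj ⟨j, hj, Or.inl ⟨h, ht⟩⟩ (by simp [ht])
      · exact .east j' hj (.turnEast _ _ _ h ht hj) (by simp [ht])
  | east =>
    have key : (B i j = .horizontal ∨ B i j = .cross) → Next B y i j .east := by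
      intro ht
      rcases right with hj | ⟨j', hj⟩
      · exact .exit hj ⟨j, hj, Or.inr ⟨h, ht⟩⟩ (Or.inr ⟨rfl, ht⟩)
      · exact .east j' hj (.straightEast _ _ _ h ht hj) (Or.inr ⟨rfl, ht⟩)
    rcases he with ht | ht | ht
    · exact key (Or.inl ht)
    · exact key (Or.inr ht)
    · obtain ⟨i', hi⟩ := up (by simp [Tile.hasN, ht])
      exact .north i' hi (.turnNorth _ _ _ h ht hi) (by simp [ht])

theorem Enters.exists_isPipe {B : Tiling n} (hB : IsBPD B) {y i j : Fin n} {d : Dir}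
    (h : Enters B y i j d) : ∃ x ≤ i, IsPipe B y x := by
  induction hk : i.val + (n - j.val) using Nat.strong_induction_on generalizing i j d with
  | _ k ih =>
  cases h.next hB with
  | north i' hi h' ht =>
    obtain ⟨x, hx, hp⟩ := ih _ (by omega) h' rfl
    exact ⟨x, by simp only [Fin.le_def] at *; omega, hp⟩
  | east j' hj h' ht => exact ih _ (by omega) h' rfl
  | exit hj h' ht => exact ⟨i, le_rfl, h'⟩

/-- Pipes never move down, so the exit row is the topmost row that a pipe visits. -/
theorem HasPerm.le_of_enters {w : Equiv.Perm (Fin n)} {B : Tiling n} (hB : HasPerm w B)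
    {x i j : Fin n} {d : Dir} (h : Enters B (w x) i j d) : x ≤ i := by
  obtain ⟨x', hx', hp⟩ := h.exists_isPipe hB.1
  exact (w.injective (hB.eq_of_isPipe hp)) ▸ hx'

/-- A pipe meets every diagonal at most once. -/
theorem Enters.eq_of_diag {B : Tiling n} {y i j i' j' : Fin n} {d d' : Dir}
    (h : Enters B y i j d) (h' : Enters B y i' j' d') (hd : j.val + i'.val = j'.val + i.val) :
    i = i' ∧ j = j' ∧ d = d' := by
  -- `hd` says that `j - i` agrees for both states. Each step of a pipe raises `j - i` by one, and
  -- the start has its least possible value, so the two histories can be compared step by step.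
  induction h generalizing i' j' d' with
  | start i hi =>
    have h1 := h'.col_le
    have h2 := i'.isLt
    have h3 : y = j' := Fin.ext (by have := h1.1; simp only [Fin.le_def] at this; omega)
    refine ⟨Fin.ext (by omega), h3, ?_⟩
    cases d' with
    | north => rfl
    | east => exact absurd h3 (h1.2 rfl).ne
  | straightNorth i i₁ j h ht hi ih =>
    have h1 := i.isLt
    have h2 := h.col_le.1
    simp only [Fin.le_def] at h2
    cases h' with
    | start k => omega
    | straightNorth k _ _ h3 ht' hi' =>
      obtain ⟨rfl, rfl, _⟩ := ih h3 (by omega); exact ⟨Fin.ext (by omega), rfl, rfl⟩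
    | turnEast _ k _ h3 ht' hj' => obtain ⟨rfl, rfl, _⟩ := ih h3 (by omega); simp [ht'] at ht
    | straightEast _ k _ h3 ht' hj' => obtain ⟨rfl, rfl, h⟩ := ih h3 (by omega); simp at h
    | turnNorth k _ _ h3 ht' hi' => obtain ⟨rfl, rfl, h⟩ := ih h3 (by omega); simp at h
  | turnEast i j j₁ h ht hj ih =>
    have h1 := i.isLt
    have h2 := h.col_le.1
    simp only [Fin.le_def] at h2
    cases h' with
    | start k => omega
    | straightNorth k _ _ h3 ht' hi' => obtain ⟨rfl, rfl, _⟩ := ih h3 (by omega); simp [ht] at ht'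
    | turnEast _ k _ h3 ht' hj' =>
      obtain ⟨rfl, rfl, _⟩ := ih h3 (by omega); exact ⟨rfl, Fin.ext (by omega), rfl⟩
    | straightEast _ k _ h3 ht' hj' => obtain ⟨rfl, rfl, h⟩ := ih h3 (by omega); simp at h
    | turnNorth k _ _ h3 ht' hi' => obtain ⟨rfl, rfl, h⟩ := ih h3 (by omega); simp at h
  | straightEast i j j₁ h ht hj ih =>
    have h1 := i.isLt
    have h2 := h.col_le.1
    simp only [Fin.le_def] at h2
    cases h' with
    | start k => omega
    | straightNorth k _ _ h3 ht' hi' => obtain ⟨rfl, rfl, h⟩ := ih h3 (by omega); simp at h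
    | turnEast _ k _ h3 ht' hj' => obtain ⟨rfl, rfl, h⟩ := ih h3 (by omega); simp at h
    | straightEast _ k _ h3 ht' hj' =>
      obtain ⟨rfl, rfl, _⟩ := ih h3 (by omega); exact ⟨rfl, Fin.ext (by omega), rfl⟩
    | turnNorth k _ _ h3 ht' hi' => obtain ⟨rfl, rfl, h⟩ := ih h3 (by omega); simp [ht'] at ht
  | turnNorth i i₁ j h ht hi ih =>
    have h1 := i.isLt
    have h2 := h.col_le.1
    simp only [Fin.le_def] at h2
    cases h' with
    | start k => omega
    | straightNorth k _ _ h3 ht' hi' => obtain ⟨rfl, rfl, h⟩ := ih h3 (by omega); simp at h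
    | turnEast _ k _ h3 ht' hj' => obtain ⟨rfl, rfl, h⟩ := ih h3 (by omega); simp at h
    | straightEast _ k _ h3 ht' hj' => obtain ⟨rfl, rfl, h⟩ := ih h3 (by omega); simp [ht] at ht'
    | turnNorth k _ _ h3 ht' hi' =>
      obtain ⟨rfl, rfl, _⟩ := ih h3 (by omega); exact ⟨Fin.ext (by omega), rfl, rfl⟩

/-- A pipe enters a row from below at most once, and a column from the left at most once. -/
theorem Enters.later {B : Tiling n} {y i j i' j' : Fin n} {d d' : Dir}
    (h : Enters B y i j d) (h' : Enters B y i' j' d') (hd : j.val + i'.val ≤ j'.val + i.val) :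
    (i = i' ∧ j = j' ∧ d = d') ∨
      ((d = .east → j < j' ∨ (j = j' ∧ d' = .north)) ∧
        (d = .north → i' < i ∨ (i = i' ∧ d' = .east))) := by
  -- `hd` means `j - i ≤ j' - i'`: the second state is at or after the first one along the pipe.
  rcases hd.eq_or_lt with he | hlt
  · exact Or.inl (h.eq_of_diag h' he)
  right
  induction h' with
  | start i' hi' =>
    have := h.col_le.1
    simp only [Fin.le_def] at this
    omega
  | straightNorth k i' j' h3 ht hi ih =>
    rcases (show j.val + k.val ≤ j'.val + i.val by omega).eq_or_lt with he | hl
    · obtain ⟨rfl, rfl, rfl⟩ := h.eq_of_diag h3 he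
      simp; omega
    · have := ih hl.le hl
      cases d <;> (simp_all; try omega)
  | turnEast i' k j' h3 ht hj ih =>
    rcases (show j.val + i'.val ≤ k.val + i.val by omega).eq_or_lt with he | hl
    · obtain ⟨rfl, rfl, rfl⟩ := h.eq_of_diag h3 he
      simp
    · have := ih hl.le hl
      cases d <;> (simp_all; try omega)
  | straightEast i' k j' h3 ht hj ih =>
    rcases (show j.val + i'.val ≤ k.val + i.val by omega).eq_or_lt with he | hl
    · obtain ⟨rfl, rfl, rfl⟩ := h.eq_of_diag h3 he
      simp; omega
    · have := ih hl.le hl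
      cases d <;> (simp_all; try omega)
  | turnNorth k i' j' h3 ht hi ih =>
    rcases (show j.val + k.val ≤ j'.val + i.val by omega).eq_or_lt with he | hl
    · obtain ⟨rfl, rfl, rfl⟩ := h.eq_of_diag h3 he
      simp
    · have := ih hl.le hl
      cases d <;> (simp_all; try omega)

theorem Enters.row_unique {B : Tiling n} {y i j i' : Fin n} (h : Enters B y i j .east)
    (h' : Enters B y i' j .east) : i = i' := by
  rcases le_total (j.val + i'.val) (j.val + i.val) with hd | hd
  · simpa using h.later h' hd
  · simpa [eq_comm] using h'.later h hd

theorem Enters.col_unique {B : Tiling n} {y i j j' : Fin n} (h : Enters B y i j .north)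
    (h' : Enters B y i j' .north) : j = j' := by
  rcases le_total (j.val + i.val) (j'.val + i.val) with hd | hd
  · simpa using h.later h' hd
  · simpa [eq_comm] using h'.later h hd

theorem Enters.prev {B : Tiling n} {y i j : Fin n} {d : Dir} (h : Enters B y i j d) :
    (i.val + 1 = n ∧ j = y ∧ d = .north) ∨
    (∃ i₀ d₀, i.val + 1 = i₀.val ∧ d = .north ∧ Enters B y i₀ j d₀ ∧
      ((d₀ = .north ∧ (B i₀ j = .vertical ∨ B i₀ j = .cross)) ∨
        (d₀ = .east ∧ B i₀ j = .jelbow))) ∨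
    (∃ j₀ d₀, j.val = j₀.val + 1 ∧ d = .east ∧ Enters B y i j₀ d₀ ∧
      ((d₀ = .north ∧ B i j₀ = .relbow) ∨
        (d₀ = .east ∧ (B i j₀ = .horizontal ∨ B i j₀ = .cross)))) := by
  cases h with
  | start _ hi => exact Or.inl ⟨hi, rfl, rfl⟩
  | straightNorth k _ _ h ht hi =>
    exact Or.inr (Or.inl ⟨k, _, hi, rfl, h, Or.inl ⟨rfl, ht⟩⟩)
  | turnEast _ k _ h ht hj => exact Or.inr (Or.inr ⟨k, _, hj, rfl, h, Or.inl ⟨rfl, ht⟩⟩)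
  | straightEast _ k _ h ht hj => exact Or.inr (Or.inr ⟨k, _, hj, rfl, h, Or.inr ⟨rfl, ht⟩⟩)
  | turnNorth k _ _ h ht hi => exact Or.inr (Or.inl ⟨k, _, hi, rfl, h, Or.inr ⟨rfl, ht⟩⟩)

/-! ### Relative position of two pipes; crossings are inversions -/

/-- On a common diagonal, the state `(i, j, d)` of one pipe is to the north-west of the state
`(i', j', d')` of another one. -/
def NorthWest (i : Fin n) (d : Dir) (i' : Fin n) (d' : Dir) : Prop :=
  i < i' ∨ (i = i' ∧ d = .east ∧ d' = .north)

/-- If the pipe `y` is to the north-west of the pipe `y'`, then it starts to the left of it, unless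
the two pipes have crossed before. -/
theorem Enters.lt_or_crossAt {B : Tiling n} {y y' i j i' j' : Fin n} {d d' : Dir}
    (h : Enters B y i j d) (h' : Enters B y' i' j' d') (hd : j.val + i'.val = j'.val + i.val)
    (hnw : NorthWest i d i' d') (hy : y ≠ y') :
    y < y' ∨ ∃ a b, CrossAt B y y' a b ∧ b.val + i.val < j.val + a.val := by
  -- Both pipes are followed backwards simultaneously, one step each, so that they stay on a common
  -- diagonal.
  induction hk : n - i.val + j.val using Nat.strong_induction_on generalizing i j d i' j' d' with
  | _ k ih =>
  have hi := i.isLt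
  have hi' := i'.isLt
  rcases h'.prev with ⟨h1, rfl, rfl⟩ | h'
  · left
    have := h.col_le.1
    rcases hnw with hnw | ⟨rfl, rfl, _⟩
    · omega
    · have := h.col_le.2 rfl
      omega
  rcases h.prev with ⟨h1, rfl, rfl⟩ | h
  · rcases hnw with hnw | ⟨rfl, h2, _⟩
    · omega
    · cases h2
  have step : ∀ {p q p' q' : Fin n} {d₀ d₀' : Dir}, Enters B y p q d₀ → Enters B y' p' q' d₀' →
      q.val + p'.val = q'.val + p.val → NorthWest p d₀ p' d₀' →
      q.val + 1 + i.val = j.val + p.val → n - p.val + q.val < k →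
      y < y' ∨ ∃ a b, CrossAt B y y' a b ∧ b.val + i.val < j.val + a.val := by
    intro p q p' q' d₀ d₀' h h' hd hnw hp hlt
    rcases ih _ hlt h h' hd hnw rfl with h1 | ⟨a, b, h1, h2⟩
    · exact Or.inl h1
    · exact Or.inr ⟨a, b, h1, by omega⟩
  rcases h with ⟨p, d₀, hp, rfl, h, ht⟩ | ⟨q, d₀, hq, rfl, h, ht⟩ <;>
    rcases h' with ⟨p', d₀', hp', rfl, h', ht'⟩ | ⟨q', d₀', hq', rfl, h', ht'⟩
  · rcases hnw with hnw | ⟨_, h2, _⟩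
    · exact step h h' (by omega) (Or.inl (by omega)) (by omega) (by omega)
    · cases h2
  · rcases hnw with hnw | ⟨_, h2, _⟩
    · by_cases hpi : p = i'
      · subst hpi
        obtain rfl : j = q' := Fin.ext (by omega)
        right
        refine ⟨p, j, ?_, by omega⟩
        rcases ht with ⟨rfl, ht⟩ | ⟨rfl, ht⟩ <;> rcases ht' with ⟨rfl, ht'⟩ | ⟨rfl, ht'⟩
        · simp [ht'] at ht
        · exact ⟨by rcases ht with ht | ht <;> simp_all, Or.inl ⟨h, h'⟩⟩
        · simp [ht'] at ht
        · simp [ht] at ht'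
      · exact step h h' (by omega) (Or.inl (by omega)) (by omega) (by omega)
    · cases h2
  · exact step h h' (by rcases hnw with hnw | hnw <;> omega)
      (Or.inl (by rcases hnw with hnw | hnw <;> omega)) (by omega) (by omega)
  · rcases hnw with hnw | ⟨_, _, h2⟩
    · exact step h h' (by omega) (Or.inl (by omega)) (by omega) (by omega)
    · cases h2

theorem HasPerm.eq_row {w : Equiv.Perm (Fin n)} {B : Tiling n} (hB : HasPerm w B)
    {x x' : Fin n} (h : IsPipe B (w x) x') : x = x' := w.injective (hB.eq_of_isPipe h)

theorem Tile.eq_cross {t : Tile} (hS : t.hasS) (hW : t.hasW) : t = .cross := by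
  cases t <;> simp_all [Tile.hasS, Tile.hasW]

/-- If the pipe `w x` is to the north-west of the pipe `w x'`, then it leaves the grid above it,
unless the two pipes cross later. -/
theorem HasPerm.lt_or_crossAt {w : Equiv.Perm (Fin n)} {B : Tiling n} (hB : HasPerm w B)
    {x x' i j i' j' : Fin n} {d d' : Dir}
    (h : Enters B (w x) i j d) (h' : Enters B (w x') i' j' d')
    (hd : j.val + i'.val = j'.val + i.val) (hnw : NorthWest i d i' d') :
    x < x' ∨ ∃ a b, CrossAt B (w x) (w x') a b ∧ j.val + a.val ≤ b.val + i.val := by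
  induction hk : i.val + (n - j.val) using Nat.strong_induction_on generalizing i j d i' j' d' with
  | _ k ih =>
  rcases hnw with hnw | ⟨rfl, rfl, rfl⟩
  swap
  -- In the tie the two pipes enter the same cell from the west and from the south, so its tile is a
  -- cross and they cross right there.
  · right
    obtain rfl : j = j' := Fin.ext (by omega)
    exact ⟨i, j, ⟨Tile.eq_cross (h'.entered hB.1) (h.entered hB.1), Or.inr ⟨h, h'⟩⟩, le_rfl⟩
  have hx := hB.le_of_enters h
  have step : ∀ {p q p' q' : Fin n} {d₀ d₀' : Dir}, Enters B (w x) p q d₀ →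
      Enters B (w x') p' q' d₀' → q.val + p'.val = q'.val + p.val → NorthWest p d₀ p' d₀' →
      q.val + i.val = j.val + 1 + p.val → p.val + (n - q.val) < k →
      x < x' ∨ ∃ a b, CrossAt B (w x) (w x') a b ∧ j.val + a.val ≤ b.val + i.val := by
    intro p q p' q' d₀ d₀' h h' hd hnw hp hlt
    rcases ih _ hlt h h' hd hnw rfl with h1 | ⟨a, b, h1, h2⟩
    · exact Or.inl h1
    · exact Or.inr ⟨a, b, h1, by omega⟩
  cases h'.next hB.1 with
  | exit hj' hp' =>
    have := hB.eq_row hp'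
    left; omega
  | north p' hp' h2 =>
    cases h.next hB.1 with
    | exit hj => omega
    | north p hp h1 => exact step h1 h2 (by omega) (Or.inl (by omega)) (by omega) (by omega)
    | east q hq h1 =>
      refine step h1 h2 (by omega) ?_ (by omega) (by omega)
      by_cases hpi : i = p'
      · exact Or.inr ⟨hpi, rfl, rfl⟩
      · exact Or.inl (by omega)
  | east q' hq' h2 =>
    cases h.next hB.1 with
    | exit hj => omega
    | north p hp h1 => exact step h1 h2 (by omega) (Or.inl (by omega)) (by omega) (by omega)
    | east q hq h1 => exact step h1 h2 (by omega) (Or.inl (by omega)) (by omega) (by omega)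

/-- In a reduced bumpless pipe dream, two pipes that cross form an inversion. -/
theorem HasPerm.inversion_of_cross {w : Equiv.Perm (Fin n)} {B : Tiling n} (hB : HasPerm w B)
    (hr : Reduced B) {x x' i j : Fin n} (ht : B i j = .cross) (h : Enters B (w x) i j .north)
    (h' : Enters B (w x') i j .east) : x < x' ∧ w x' < w x := by
  have hne : x ≠ x' := by
    rintro rfl
    simpa using h.eq_of_diag h' rfl
  have hc : CrossAt B (w x) (w x') i j := ⟨ht, Or.inl ⟨h, h'⟩⟩
  have hc' : CrossAt B (w x') (w x) i j := ⟨ht, Or.inr ⟨h', h⟩⟩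
  constructor
  · cases h.next hB.1 with
    | exit hj hp hd => simp [ht] at hd
    | east q hq h1 hd => simp [ht] at hd
    | north p hp h1 =>
      cases h'.next hB.1 with
      | exit hj' hp' =>
        have := hB.eq_row hp'
        have := hB.le_of_enters h1
        omega
      | north p' hp' h2 hd => simp [ht] at hd
      | east q' hq' h2 =>
        -- The states `h1`, `h2` lie one diagonal past the crossing, so a crossing found from there
        -- on would be a second one.
        rcases hB.lt_or_crossAt h1 h2 (by omega) (Or.inl (by omega)) with hlt | ⟨a, b, hab, hl⟩
        · exact hlt
        · obtain ⟨rfl, rfl⟩ := hr _ _ (w.injective.ne hne) _ _ _ _ hc hab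
          omega
  -- Before the crossing the eastbound pipe is the north-western one, by the tie rule in
  -- `NorthWest`; an earlier crossing is again excluded by reducedness.
  · rcases h'.lt_or_crossAt h rfl (Or.inr ⟨rfl, rfl, rfl⟩) (w.injective.ne hne.symm) with
      hlt | ⟨a, b, hab, hl⟩
    · exact hlt
    · obtain ⟨rfl, rfl⟩ := hr _ _ (w.injective.ne hne.symm) _ _ _ _ hc' hab
      omega

/-! ### Counting tiles: the weight is a power of `1 + β` -/

theorem HasPerm.numTile_cross_le {w : Equiv.Perm (Fin n)} {B : Tiling n} (hB : HasPerm w B)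
    (hr : Reduced B) : numTile .cross B ≤ permLength B := by
  have hex : ∀ p : Fin n × Fin n, ∃ q : Fin n × Fin n, B p.1 p.2 = .cross →
      Enters B (w q.1) p.1 p.2 .north ∧ Enters B (w q.2) p.1 p.2 .east := by
    intro p
    by_cases hp : B p.1 p.2 = .cross
    · obtain ⟨y, hy⟩ := hB.1.exists_enters p.1 p.2 .north (by simp [Tile.entered, Tile.hasS, hp])
      obtain ⟨y', hy'⟩ := hB.1.exists_enters p.1 p.2 .east (by simp [Tile.entered, Tile.hasW, hp])
      exact ⟨(w.symm y, w.symm y'), fun _ => by simpa using ⟨hy, hy'⟩⟩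
    · exact ⟨p, fun h => absurd h hp⟩
  choose f hf using hex
  refine Finset.card_le_card_of_injOn f ?_ ?_
  · intro p hp
    simp only [Finset.coe_filter, Finset.mem_univ, true_and, Set.mem_ofPred_eq] at hp ⊢
    have hi := hB.inversion_of_cross hr hp (hf p hp).1 (hf p hp).2
    exact ⟨hi.1, _, _, hi.2, hB.2 _, hB.2 _⟩
  -- Two crosses with the same inversion would be two crossings of the same two pipes.
  · intro p hp p' hp' he
    simp only [Finset.coe_filter, Finset.mem_univ, true_and, Set.mem_ofPred_eq] at hp hp'
    have hi := hB.inversion_of_cross hr hp (hf p hp).1 (hf p hp).2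
    have h1 := hf p hp
    have h2 := hf p' hp'
    rw [← he] at h2
    have := hr _ _ hi.2.ne _ _ _ _ ⟨hp, Or.inr ⟨h1.2, h1.1⟩⟩ ⟨hp', Or.inr ⟨h2.2, h2.1⟩⟩
    exact Prod.ext this.1 this.2

/-- In a square lattice configuration with domain wall boundary, `j` horizontal edges are used
between the columns `j - 1` and `j`. -/
theorem sum_horizontal_edges (E W S N : Fin n → Fin n → ℤ)
    (hbal : ∀ i j, E i j - W i j = S i j - N i j)
    (horiz : ∀ i j j' : Fin n, j'.val = j.val + 1 → W i j' = E i j)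
    (vert : ∀ i i' j : Fin n, i'.val = i.val + 1 → N i' j = S i j)
    (west : ∀ i j : Fin n, j.val = 0 → W i j = 0)
    (north : ∀ i j : Fin n, i.val = 0 → N i j = 0)
    (south : ∀ i j : Fin n, i.val + 1 = n → S i j = 1) :
    ∑ i, ∑ j, (E i j + W i j) = n * n := by
  -- Vertical edges telescope along a column from the unused north side to the used south side. By
  -- `hbal`, each column therefore adds one used horizontal edge.
  have tel : ∀ j, ∑ i, (S i j - N i j) = 1 := by
    intro j
    -- The vertical edge of column `j` below `k` rows; the default value `1` is the edge on the
    -- south side.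
    let f : ℕ → ℤ := fun k => if h : k < n then N ⟨k, h⟩ j else 1
    have hn : 0 < n := by have := j.isLt; omega
    have hf : ∀ i : Fin n, S i j - N i j = f (i.val + 1) - f i.val := by
      intro i
      have h2 : f i.val = N i j := by simp [f]
      have h1 : f (i.val + 1) = S i j := by
        by_cases h : i.val + 1 < n
        · simp only [f, h, dif_pos]; exact vert _ _ _ rfl
        · simp only [f, h, dif_neg, not_false_iff]; exact (south _ _ (by omega)).symm
      rw [h1, h2]
    rw [Finset.sum_congr rfl fun i _ => hf i,
      Fin.sum_univ_eq_sum_range (fun k => f (k + 1) - f k) n, Finset.sum_range_sub]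
    simp [f, hn, north ⟨0, hn⟩ j rfl]
  have col : ∀ (k : ℕ) (hk : k < n), ∑ i, W i ⟨k, hk⟩ = k := by
    intro k
    induction k with
    | zero => intro hk; simpa using Finset.sum_eq_zero fun i _ => west i ⟨0, hk⟩ rfl
    | succ k ih =>
      intro hk
      have h1 := ih (by omega)
      have h2 := tel ⟨k, by omega⟩
      rw [← Finset.sum_congr rfl fun i _ => hbal i ⟨k, by omega⟩, Finset.sum_sub_distrib, h1] at h2
      rw [Finset.sum_congr rfl fun i _ => horiz i ⟨k, by omega⟩ ⟨k + 1, hk⟩ rfl]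
      push_cast; linarith
  have h3 : ∀ j : Fin n, ∑ i, (E i j + W i j) = 2 * j.val + 1 := by
    intro j
    have h1 := col j.val j.isLt
    have h2 := tel j
    rw [← Finset.sum_congr rfl fun i _ => hbal i j, Finset.sum_sub_distrib] at h2
    rw [Finset.sum_add_distrib]
    simp only [Fin.eta] at h1
    linarith
  rw [Finset.sum_comm, Finset.sum_congr rfl fun j _ => h3 j,
    Fin.sum_univ_eq_sum_range (fun k => 2 * (k : ℤ) + 1) n]
  clear * -
  induction n with
  | zero => simp
  | succ k ih => rw [Finset.sum_range_succ, ih]; push_cast; ring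

-- A cross has four used edges, a blank none, and every other tile two. Counted cell by cell, the
-- horizontal edges contribute `n²` in all, and so do the vertical ones, so the average is two per
-- cell and crosses balance blanks.
open Classical in
theorem IsBPD.numTile_blank {B : Tiling n} (hB : IsBPD B) :
    numTile .blank B = numTile .cross B := by
  let ind : Prop → ℤ := fun p => if p then 1 else 0
  have hcongr : ∀ {p q : Prop}, (p ↔ q) → ind p = ind q := fun h => by simp [h]
  have h0 : ∀ {p : Prop}, ¬ p → ind p = 0 := fun h => by simp [ind, h]
  have h1 : ∀ {p : Prop}, p → ind p = 1 := fun h => by simp [ind, h]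
  have hbal : ∀ i j, ind (B i j).hasE - ind (B i j).hasW = ind (B i j).hasS - ind (B i j).hasN := by
    intro i j
    cases B i j <;> simp [ind, Tile.hasE, Tile.hasW, Tile.hasS, Tile.hasN]
  have hh := sum_horizontal_edges (fun i j => ind (B i j).hasE) (fun i j => ind (B i j).hasW)
    (fun i j => ind (B i j).hasS) (fun i j => ind (B i j).hasN) hbal
    (fun i j j' h => hcongr (hB.horiz i j j' h).symm)
    (fun i i' j h => hcongr (hB.vert i i' j h).symm)
    (fun i j h => h0 (hB.west i j h)) (fun i j h => h0 (hB.north i j h))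
    (fun i j h => h1 (hB.south i j h))
  have hv := sum_horizontal_edges (fun j i => ind (B i j).hasS) (fun j i => ind (B i j).hasN)
    (fun j i => ind (B i j).hasE) (fun j i => ind (B i j).hasW) (fun j i => (hbal i j).symm)
    (fun j i i' h => hcongr (hB.vert i i' j h).symm)
    (fun j j' i h => hcongr (hB.horiz i j j' h).symm)
    (fun j i h => h0 (hB.north i j h)) (fun j i h => h0 (hB.west i j h))
    (fun j i h => h1 (hB.east i j h))
  rw [Finset.sum_comm] at hv
  have hcount : ∀ t, (numTile t B : ℤ) = ∑ i, ∑ j, ind (B i j = t) := by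
    intro t
    rw [numTile, Finset.card_filter]
    push_cast
    rw [← Finset.univ_product_univ, Finset.sum_product]
    refine Finset.sum_congr rfl fun i _ => Finset.sum_congr rfl fun j _ => ?_
    by_cases h : B i j = t <;> simp [ind, h]
  have htile : ∀ i j, 2 * ind (B i j = .cross) - 2 * ind (B i j = .blank) =
      (ind (B i j).hasE + ind (B i j).hasW) + (ind (B i j).hasS + ind (B i j).hasN) - 2 := by
    intro i j
    cases B i j <;> simp [ind, Tile.hasE, Tile.hasW, Tile.hasS, Tile.hasN]
  have hsum := Finset.sum_congr (rfl : (Finset.univ : Finset (Fin n)) = _) fun i _ =>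
    Finset.sum_congr (rfl : (Finset.univ : Finset (Fin n)) = _) fun j _ => htile i j
  simp only [Finset.sum_sub_distrib, Finset.sum_add_distrib, ← Finset.mul_sum, ← hcount] at hsum
  simp only [Finset.sum_add_distrib] at hh hv
  simp at hsum
  have : (numTile .blank B : ℤ) = numTile .cross B := by linarith
  exact_mod_cast this

/-- The subtraction in the exponent is truncated, so the inequality between blanks and length is
enough. -/
theorem HasPerm.wt_eq {R : Type*} [CommRing R] (β : R) {w : Equiv.Perm (Fin n)} {B : Tiling n}
    (hB : HasPerm w B) (hr : Reduced B) : wt β B = (1 + β) ^ numTile .jelbow B := by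
  have h := hB.numTile_cross_le hr
  rw [← hB.1.numTile_blank] at h
  simp [wt, Nat.sub_eq_zero_of_le h]

/-! ### Hooks -/

/-- The cell `(x, y)` is an r-elbow, the only one in its row and the only one in its column. -/
structure IsHook (B : Tiling n) (x y : Fin n) : Prop where
  relbow : B x y = .relbow
  row : ∀ j, B x j = .relbow → j = y
  col : ∀ i, B i y = .relbow → i = x

/-- The west side is unused, and going right a horizontal strand can begin only at an r-elbow. -/
theorem IsHook.row_left {B : Tiling n} (hB : IsBPD B) {x y : Fin n} (h : IsHook B x y)
    {j : Fin n} (hj : j < y) : ¬ (B x j).hasE ∧ ¬ (B x j).hasW := by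
  induction hk : j.val generalizing j with
  | zero =>
    have h1 := hB.west x j hk
    have h2 : B x j ≠ .relbow := fun h2 => hj.ne (h.row j h2)
    generalize B x j = t at h1 h2
    cases t <;> simp_all [Tile.hasE, Tile.hasW]
  | succ k ih =>
    obtain ⟨j', hj'⟩ : ∃ j' : Fin n, j'.val = k := ⟨⟨k, by omega⟩, rfl⟩
    have h1 := mt (hB.horiz x j' j (by omega)).2 (ih (j := j') (by omega) hj').1
    have h2 : B x j ≠ .relbow := fun h2 => hj.ne (h.row j h2)
    generalize B x j = t at h1 h2
    cases t <;> simp_all [Tile.hasE, Tile.hasW]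

/-- Read from the east side, which is used: going left, a used horizontal edge can stop only at an
r-elbow. -/
theorem IsHook.row_right {B : Tiling n} (hB : IsBPD B) {x y : Fin n} (h : IsHook B x y)
    {j : Fin n} (hj : y < j) : (B x j).hasE ∧ (B x j).hasW := by
  have key : (B x j).hasE → (B x j).hasE ∧ (B x j).hasW := by
    intro h1
    have h2 : B x j ≠ .relbow := fun h2 => hj.ne' (h.row j h2)
    generalize B x j = t at h1 h2
    cases t <;> simp_all [Tile.hasE, Tile.hasW]
  induction hk : n - j.val generalizing j with
  | zero => omega
  | succ k ih =>
    by_cases hn : j.val + 1 = n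
    · exact key (hB.east x j hn)
    · obtain ⟨j', hj'⟩ : ∃ j' : Fin n, j'.val = j.val + 1 := ⟨⟨j.val + 1, by omega⟩, rfl⟩
      refine key ((hB.horiz x j j' hj').2 (ih (j := j') (by omega) ?_ (by omega)).2)
      intro h1
      have h2 : B x j' ≠ .relbow := fun h2 => by have := h.row j' h2; omega
      generalize B x j' = t at h1 h2
      cases t <;> simp_all [Tile.hasE, Tile.hasW]

/-- The reflection of a tile in the main diagonal. -/
def Tile.transpose : Tile → Tile
  | .horizontal => .vertical
  | .vertical => .horizontal
  | t => t

@[simp] theorem Tile.transpose_hasE (t : Tile) : t.transpose.hasE ↔ t.hasS := by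
  cases t <;> simp [Tile.transpose, Tile.hasE, Tile.hasS]

@[simp] theorem Tile.transpose_hasS (t : Tile) : t.transpose.hasS ↔ t.hasE := by
  cases t <;> simp [Tile.transpose, Tile.hasE, Tile.hasS]

@[simp] theorem Tile.transpose_hasW (t : Tile) : t.transpose.hasW ↔ t.hasN := by
  cases t <;> simp [Tile.transpose, Tile.hasW, Tile.hasN]

@[simp] theorem Tile.transpose_hasN (t : Tile) : t.transpose.hasN ↔ t.hasW := by
  cases t <;> simp [Tile.transpose, Tile.hasW, Tile.hasN]

@[simp] theorem Tile.transpose_eq_relbow (t : Tile) : t.transpose = .relbow ↔ t = .relbow := by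
  cases t <;> simp [Tile.transpose]

@[simp] theorem Tile.transpose_eq_jelbow (t : Tile) : t.transpose = .jelbow ↔ t = .jelbow := by
  cases t <;> simp [Tile.transpose]

/-- The reflection of a filling in the main diagonal. -/
def transpose (B : Tiling n) : Tiling n := fun i j => (B j i).transpose

theorem IsBPD.transpose {B : Tiling n} (hB : IsBPD B) : IsBPD (transpose B) where
  horiz i j j' h := by simpa [BumplessPipeDream.transpose] using hB.vert j j' i h
  vert i i' j h := by simpa [BumplessPipeDream.transpose] using hB.horiz j i i' h
  west i j h := by simpa [BumplessPipeDream.transpose] using hB.north j i h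
  north i j h := by simpa [BumplessPipeDream.transpose] using hB.west j i h
  east i j h := by simpa [BumplessPipeDream.transpose] using hB.south j i h
  south i j h := by simpa [BumplessPipeDream.transpose] using hB.east j i h

theorem IsHook.transpose {B : Tiling n} {x y : Fin n} (h : IsHook B x y) :
    IsHook (transpose B) y x where
  relbow := by simpa [BumplessPipeDream.transpose] using h.relbow
  row j hj := h.col j (by simpa [BumplessPipeDream.transpose] using hj)
  col i hi := h.row i (by simpa [BumplessPipeDream.transpose] using hi)

theorem IsHook.col_above {B : Tiling n} (hB : IsBPD B) {x y : Fin n} (h : IsHook B x y)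
    {i : Fin n} (hi : i < x) : ¬ (B i y).hasS ∧ ¬ (B i y).hasN := by
  simpa [BumplessPipeDream.transpose] using h.transpose.row_left hB.transpose hi

theorem IsHook.col_below {B : Tiling n} (hB : IsBPD B) {x y : Fin n} (h : IsHook B x y)
    {i : Fin n} (hi : x < i) : (B i y).hasS ∧ (B i y).hasN := by
  simpa [BumplessPipeDream.transpose] using h.transpose.row_right hB.transpose hi

theorem Tile.straight_of_hasE_iff {t : Tile} (h : t.hasE ↔ t.hasW) : t.Straight := by
  cases t <;> simp_all [Tile.Straight, hasE, hasW]

theorem Tile.straight_of_hasS_iff {t : Tile} (h : t.hasS ↔ t.hasN) : t.Straight := by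
  cases t <;> simp_all [Tile.Straight, hasS, hasN]

theorem IsHook.straight_row {B : Tiling n} (hB : IsBPD B) {x y : Fin n} (h : IsHook B x y)
    {j : Fin n} (hj : j ≠ y) : (B x j).Straight := by
  rcases lt_or_gt_of_ne hj with hj | hj
  · exact Tile.straight_of_hasE_iff (iff_of_false (h.row_left hB hj).1 (h.row_left hB hj).2)
  · exact Tile.straight_of_hasE_iff (iff_of_true (h.row_right hB hj).1 (h.row_right hB hj).2)

theorem IsHook.straight_col {B : Tiling n} (hB : IsBPD B) {x y : Fin n} (h : IsHook B x y)
    {i : Fin n} (hi : i ≠ x) : (B i y).Straight := by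
  rcases lt_or_gt_of_ne hi with hi | hi
  · exact Tile.straight_of_hasS_iff (iff_of_false (h.col_above hB hi).1 (h.col_above hB hi).2)
  · exact Tile.straight_of_hasS_iff (iff_of_true (h.col_below hB hi).1 (h.col_below hB hi).2)

/-- The pipe of a hook goes straight north and then straight east. -/
theorem IsHook.of_enters {B : Tiling n} (hB : IsBPD B) {x y i j : Fin n} {d : Dir}
    (h : IsHook B x y) (he : Enters B y i j d) :
    (d = .north ∧ j = y ∧ x ≤ i) ∨ (d = .east ∧ i = x ∧ y < j) := by
  induction he with
  | start i hi => exact Or.inl ⟨rfl, rfl, by omega⟩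
  | straightNorth i i' j he ht hi ih =>
    rcases ih with ⟨-, rfl, h2⟩ | ⟨h0, -⟩
    · have : i ≠ x := by
        rintro rfl
        simp [h.relbow] at ht
      exact Or.inl ⟨rfl, rfl, by omega⟩
    · cases h0
  | turnEast i j j' he ht hj ih =>
    rcases ih with ⟨-, rfl, h2⟩ | ⟨h0, -⟩
    · exact Or.inr ⟨rfl, h.col i ht, by omega⟩
    · cases h0
  | straightEast i j j' he ht hj ih =>
    rcases ih with ⟨h0, -⟩ | ⟨-, h1, h2⟩
    · cases h0
    · exact Or.inr ⟨rfl, h1, by omega⟩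
  | turnNorth i i' j he ht hi ih =>
    rcases ih with ⟨h0, -⟩ | ⟨-, rfl, h2⟩
    · cases h0
    · exact absurd ht (h.straight_row hB h2.ne').2

/-! ### Straight stretches of pipes -/

theorem exists_last (r : Fin n) : ∃ e : Fin n, e.val + 1 = n := by
  have hn := r.isLt
  exact ⟨⟨n - 1, by omega⟩, by simp; omega⟩

/-- A pipe that goes straight north through the cells of a column. -/
theorem Enters.pass_north {B : Tiling n} (hB : IsBPD B) {y r r' c : Fin n}
    (h : Enters B y r c .north) (hr : r' ≤ r)
    (hs : ∀ k, r' < k → k ≤ r → (B k c).Straight) : Enters B y r' c .north := by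
  induction hk : r.val - r'.val generalizing r with
  | zero => obtain rfl : r = r' := Fin.ext (by omega); exact h
  | succ k ih =>
    obtain ⟨q, hq⟩ : ∃ q : Fin n, q.val + 1 = r.val := ⟨⟨r.val - 1, by omega⟩, by simp; omega⟩
    have ht := (hs r (by omega) le_rfl).north (h.entered hB)
    exact ih (.straightNorth _ q _ h ht hq) (by omega)
      (fun k h1 h2 => hs k h1 (by omega)) (by omega)

theorem Enters.pass_east {B : Tiling n} (hB : IsBPD B) {y r c c' : Fin n}
    (h : Enters B y r c .east) (hc : c ≤ c')
    (hs : ∀ k, c ≤ k → k < c' → (B r k).Straight) : Enters B y r c' .east := by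
  induction hk : c'.val - c.val generalizing c with
  | zero => obtain rfl : c = c' := Fin.ext (by omega); exact h
  | succ k ih =>
    obtain ⟨q, hq⟩ : ∃ q : Fin n, q.val = c.val + 1 := ⟨⟨c.val + 1, by omega⟩, rfl⟩
    have ht := (hs c le_rfl (by omega)).east (h.entered hB)
    exact ih (.straightEast _ _ q h ht hq) (by omega)
      (fun k h1 h2 => hs k (by omega) h2) (by omega)

/-- A pipe that goes straight east until it leaves the grid. -/
theorem Enters.isPipe_of_straight {B : Tiling n} (hB : IsBPD B) {y r c : Fin n}
    (h : Enters B y r c .east) (hs : ∀ k, c ≤ k → (B r k).Straight) : IsPipe B y r := by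
  obtain ⟨e, he⟩ := exists_last r
  have h' := h.pass_east hB (c' := e) (by omega) fun k h1 _ => hs k h1
  exact ⟨e, he, Or.inr ⟨h', (hs e (by omega)).east (h'.entered hB)⟩⟩

theorem isPipe_of_straight_right {B : Tiling n} (hB : IsBPD B) {y r c : Fin n}
    (h : Enters B y r c .north) (ht : B r c = .relbow) (hs : ∀ k, c < k → (B r k).Straight) :
    IsPipe B y r := by
  by_cases hc : c.val + 1 = n
  · exact ⟨c, hc, Or.inl ⟨h, ht⟩⟩
  · obtain ⟨q, hq⟩ : ∃ q : Fin n, q.val = c.val + 1 := ⟨⟨c.val + 1, by omega⟩, rfl⟩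
    exact (Enters.turnEast _ _ q h ht hq).isPipe_of_straight hB fun k hk => hs k (by omega)

theorem enters_of_straight_below {B : Tiling n} (hB : IsBPD B) {r c : Fin n}
    (hs : ∀ k, r < k → (B k c).Straight) : Enters B c r c .north := by
  obtain ⟨e, he⟩ := exists_last r
  exact (Enters.start (B := B) (y := c) e he).pass_north hB (by omega) fun k h1 _ => hs k h1

theorem IsHook.isPipe {B : Tiling n} (hB : IsBPD B) {x y : Fin n} (h : IsHook B x y) :
    IsPipe B y x :=
  isPipe_of_straight_right hB
    (enters_of_straight_below hB fun _ hk => h.straight_col hB hk.ne') h.relbow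
    fun _ hk => h.straight_row hB hk.ne'

/-- The pipe through a hook is automatically `y → x`, so removability is a condition on tiles alone,
with no tracing of pipes. -/
theorem IsBPD.removable_iff {B : Tiling n} (hB : IsBPD B) {x y : Fin n} :
    Removable B y x ↔ IsHook B x y :=
  ⟨fun h => ⟨h.2.1, h.2.2.1, h.2.2.2⟩, fun h => ⟨h.isPipe hB, h.relbow, h.row, h.col⟩⟩

/-! ### Deleting hooks -/

/-- The bumpless pipe dream `B` has hooks at `(x, w x)` for all `x` not in the range of `s`, and the
columns of these hooks are those not in the range of `t`. -/
structure Hooked (w : Equiv.Perm (Fin n)) (s t : Fin m ↪o Fin n) (B : Tiling n) : Prop where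
  isBPD : IsBPD B
  range : ∀ x, w x ∈ Set.range t ↔ x ∈ Set.range s
  hook : ∀ x, x ∉ Set.range s → IsHook B x (w x)

theorem not_mem_range_between {s : Fin m ↪o Fin n} {i i' : Fin m} (hi : i'.val = i.val + 1)
    {k : Fin n} (h1 : s i < k) (h2 : k < s i') : k ∉ Set.range s := by
  rintro ⟨a, rfl⟩
  have h3 := s.lt_iff_lt.1 h1
  have h4 := s.lt_iff_lt.1 h2
  omega

theorem not_mem_range_first {s : Fin m ↪o Fin n} {i : Fin m} (hi : i.val = 0)
    {k : Fin n} (h : k < s i) : k ∉ Set.range s := by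
  rintro ⟨a, rfl⟩
  have := s.lt_iff_lt.1 h
  omega

theorem not_mem_range_last {s : Fin m ↪o Fin n} {i : Fin m} (hi : i.val + 1 = m)
    {k : Fin n} (h : s i < k) : k ∉ Set.range s := by
  rintro ⟨a, rfl⟩
  have := s.lt_iff_lt.1 h
  omega

section
variable {w : Equiv.Perm (Fin n)} {s t : Fin m ↪o Fin n} {B : Tiling n}

theorem Hooked.straight_row (h : Hooked w s t B) {x : Fin n} (hx : x ∉ Set.range s) (j : Fin m) :
    (B x (t j)).Straight := by
  refine (h.hook x hx).straight_row h.isBPD ?_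
  intro hj
  exact hx ((h.range x).1 ⟨j, hj⟩)

theorem Hooked.exists_col (h : Hooked w s t B) {c : Fin n} (hc : c ∉ Set.range t) :
    ∃ x, x ∉ Set.range s ∧ w x = c :=
  ⟨w.symm c, by rwa [← h.range, w.apply_symm_apply], w.apply_symm_apply c⟩

theorem Hooked.straight_col (h : Hooked w s t B) {c : Fin n} (hc : c ∉ Set.range t) (i : Fin m) :
    (B (s i) c).Straight := by
  obtain ⟨x, hx, rfl⟩ := h.exists_col hc
  refine (h.hook x hx).straight_col h.isBPD ?_
  rintro rfl
  exact hx ⟨i, rfl⟩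

/-- Straight cells pass edges on unchanged, so the cells on both sides of a deleted stretch still
match. -/
theorem horiz_iff_of_straight (hB : IsBPD B) {r c c' : Fin n} (hc : c < c')
    (hs : ∀ k, c < k → k < c' → (B r k).Straight) : (B r c).hasE ↔ (B r c').hasW := by
  induction hk : c'.val - c.val generalizing c with
  | zero => omega
  | succ k ih =>
    obtain ⟨q, hq⟩ : ∃ q : Fin n, q.val = c.val + 1 := ⟨⟨c.val + 1, by omega⟩, rfl⟩
    rw [hB.horiz r c q hq]
    by_cases hqc : q = c'
    · rw [hqc]
    · rw [← (hs q (by omega) (by omega)).hasE_iff]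
      exact ih (by omega) (fun k h1 h2 => hs k (by omega) h2) (by omega)

theorem hasW_of_straight (hB : IsBPD B) {r c : Fin n}
    (hs : ∀ k, k < c → (B r k).Straight) : ¬ (B r c).hasW := by
  by_cases hc : c.val = 0
  · exact hB.west r c hc
  · obtain ⟨z, hz⟩ : ∃ z : Fin n, z.val = 0 := ⟨⟨0, by omega⟩, rfl⟩
    rw [← horiz_iff_of_straight hB (c := z) (by omega) fun k _ h2 => hs k h2,
      (hs z (by omega)).hasE_iff]
    exact hB.west r z hz

theorem hasE_of_straight (hB : IsBPD B) {r c : Fin n}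
    (hs : ∀ k, c < k → (B r k).Straight) : (B r c).hasE := by
  obtain ⟨z, hz⟩ := exists_last r
  by_cases hc : c = z
  · exact hB.east r c (hc ▸ hz)
  · rw [horiz_iff_of_straight hB (c' := z) (by omega) fun k h2 _ => hs k h2,
      ← (hs z (by omega)).hasE_iff]
    exact hB.east r z hz

theorem Hooked.transpose (h : Hooked w s t B) : Hooked w.symm t s (transpose B) where
  isBPD := h.isBPD.transpose
  range x := by rw [← h.range, w.apply_symm_apply]
  hook x hx := by
    have := (h.hook (w.symm x) (by rwa [← h.range, w.apply_symm_apply])).transpose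
    rwa [w.apply_symm_apply] at this

/-- Deleting hooks from a bumpless pipe dream leaves a bumpless pipe dream. -/
theorem Hooked.isBPD_submatrix (h : Hooked w s t B) : IsBPD fun i j => B (s i) (t j) where
  horiz i j j' hj := horiz_iff_of_straight h.isBPD (t.lt_iff_lt.2 (by omega))
    fun k h1 h2 => h.straight_col (not_mem_range_between hj h1 h2) i
  west i j hj := hasW_of_straight h.isBPD fun k hk => h.straight_col (not_mem_range_first hj hk) i
  east i j hj := hasE_of_straight h.isBPD fun k hk => h.straight_col (not_mem_range_last hj hk) i
  vert i i' j hi := by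
    have := horiz_iff_of_straight h.transpose.isBPD (r := t j) (s.lt_iff_lt.2 (by omega))
      fun k h1 h2 => h.transpose.straight_col (not_mem_range_between hi h1 h2) j
    simpa [BumplessPipeDream.transpose] using this
  north i j hi := by
    have := hasW_of_straight h.transpose.isBPD (r := t j) (c := s i)
      fun k hk => h.transpose.straight_col (not_mem_range_first hi hk) j
    simpa [BumplessPipeDream.transpose] using this
  south i j hi := by
    have := hasE_of_straight h.transpose.isBPD (r := t j) (c := s i)
      fun k hk => h.transpose.straight_col (not_mem_range_last hi hk) j
    simpa [BumplessPipeDream.transpose] using this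

theorem Hooked.step_north (h : Hooked w s t B) {y : Fin n} {i i' j : Fin m}
    (hi : i'.val + 1 = i.val) {r : Fin n} (hr : r.val + 1 = (s i).val)
    (he : Enters B y r (t j) .north) : Enters B y (s i') (t j) .north := by
  have h1 : s i' < s i := s.lt_iff_lt.2 (by omega)
  exact he.pass_north h.isBPD (by omega) fun k h2 h3 =>
    h.straight_row (not_mem_range_between hi.symm h2 (by omega)) j

theorem Hooked.step_east (h : Hooked w s t B) {y : Fin n} {i j j' : Fin m}
    (hj : j'.val = j.val + 1) {c : Fin n} (hc : c.val = (t j).val + 1)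
    (he : Enters B y (s i) c .east) : Enters B y (s i) (t j') .east := by
  have h1 : t j < t j' := t.lt_iff_lt.2 (by omega)
  exact he.pass_east h.isBPD (by omega) fun k h2 h3 =>
    h.straight_col (not_mem_range_between hj (by omega) h3) i

/-- The pipes that remain after deleting hooks follow the original pipes. -/
theorem Hooked.enters (h : Hooked w s t B) {y i j : Fin m} {d : Dir}
    (he : Enters (fun i j => B (s i) (t j)) y i j d) : Enters B (t y) (s i) (t j) d := by
  induction he with
  | start i hi =>
    exact enters_of_straight_below h.isBPD fun k hk =>
      h.straight_row (not_mem_range_last hi hk) y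
  | straightNorth i i' j he ht hi ih =>
    have h1 : s i' < s i := s.lt_iff_lt.2 (by omega)
    obtain ⟨r, hr⟩ : ∃ r : Fin n, r.val + 1 = (s i).val :=
      ⟨⟨(s i).val - 1, by omega⟩, by simp; omega⟩
    exact h.step_north hi hr (.straightNorth _ _ _ ih ht hr)
  | turnNorth i i' j he ht hi ih =>
    have h1 : s i' < s i := s.lt_iff_lt.2 (by omega)
    obtain ⟨r, hr⟩ : ∃ r : Fin n, r.val + 1 = (s i).val :=
      ⟨⟨(s i).val - 1, by omega⟩, by simp; omega⟩
    exact h.step_north hi hr (.turnNorth _ _ _ ih ht hr)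
  | straightEast i j j' he ht hj ih =>
    have h1 : t j < t j' := t.lt_iff_lt.2 (by omega)
    obtain ⟨c, hc⟩ : ∃ c : Fin n, c.val = (t j).val + 1 := ⟨⟨(t j).val + 1, by omega⟩, rfl⟩
    exact h.step_east hj hc (.straightEast _ _ _ ih ht hc)
  | turnEast i j j' he ht hj ih =>
    have h1 : t j < t j' := t.lt_iff_lt.2 (by omega)
    obtain ⟨c, hc⟩ : ∃ c : Fin n, c.val = (t j).val + 1 := ⟨⟨(t j).val + 1, by omega⟩, rfl⟩
    exact h.step_east hj hc (.turnEast _ _ _ ih ht hc)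

theorem Hooked.isPipe (h : Hooked w s t B) {y i : Fin m}
    (hp : IsPipe (fun i j => B (s i) (t j)) y i) : IsPipe B (t y) (s i) := by
  obtain ⟨j, hj, ⟨he, ht⟩ | ⟨he, ht⟩⟩ := hp
  · exact isPipe_of_straight_right h.isBPD (h.enters he) ht fun k hk =>
      h.straight_col (not_mem_range_last hj hk) i
  · refine (h.enters he).isPipe_of_straight h.isBPD fun k hk => ?_
    rcases hk.eq_or_lt with rfl | hk
    · rcases ht with ht | ht <;> simp [Tile.Straight, ht]
    · exact h.straight_col (not_mem_range_last hj hk) i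

/-- For the converse, the edge is used in the submatrix as well, hence entered there by some pipe;
that pipe lifts to `B`, where only one pipe enters the edge. -/
theorem Hooked.enters_iff (h : Hooked w s t B) {y i j : Fin m} {d : Dir} :
    Enters (fun i j => B (s i) (t j)) y i j d ↔ Enters B (t y) (s i) (t j) d := by
  refine ⟨h.enters, fun he => ?_⟩
  have h1 := he.entered h.isBPD
  obtain ⟨y', hy'⟩ := h.isBPD_submatrix.exists_enters i j d h1
  exact t.injective (he.unique (h.enters hy')) ▸ hy'

theorem Hooked.crossAt_iff (h : Hooked w s t B) {y y' i j : Fin m} :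
    CrossAt (fun i j => B (s i) (t j)) y y' i j ↔ CrossAt B (t y) (t y') (s i) (t j) := by
  simp only [CrossAt, h.enters_iff]

theorem Hooked.reduced_submatrix (h : Hooked w s t B) (hr : Reduced B) :
    Reduced fun i j => B (s i) (t j) := by
  intro y y' hy i j i' j' hc hc'
  have := hr _ _ (t.injective.ne hy) _ _ _ _ (h.crossAt_iff.1 hc) (h.crossAt_iff.1 hc')
  exact ⟨s.injective this.1, t.injective this.2⟩

theorem Hooked.hasPerm_submatrix (h : Hooked w s t B) (hw : HasPerm w B)
    {u : Equiv.Perm (Fin m)} (hu : ∀ i, t (u i) = w (s i)) :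
    HasPerm u fun i j => B (s i) (t j) := by
  refine ⟨h.isBPD_submatrix, fun i => ?_⟩
  obtain ⟨y, hy⟩ := h.isBPD_submatrix.exists_isPipe i
  have := hw.eq_of_isPipe (h.isPipe hy)
  rw [← hu] at this
  exact t.injective this ▸ hy

/-- In kept rows and columns the deleted cells are straight, so no r-elbow that could compete with
the corner is lost. -/
theorem Hooked.isHook_submatrix_iff (h : Hooked w s t B) {x y : Fin m} :
    IsHook (fun i j => B (s i) (t j)) x y ↔ IsHook B (s x) (t y) := by
  constructor
  · intro hh
    refine ⟨hh.relbow, fun j hj => ?_, fun i hi => ?_⟩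
    · by_cases hjt : j ∈ Set.range t
      · obtain ⟨j, rfl⟩ := hjt
        rw [hh.row j hj]
      · exact absurd hj (h.straight_col hjt x).1
    · by_cases his : i ∈ Set.range s
      · obtain ⟨i, rfl⟩ := his
        rw [hh.col i hi]
      · exact absurd hi (h.straight_row his y).1
  · intro hh
    exact ⟨hh.relbow, fun j hj => t.injective (hh.row _ hj), fun i hi => s.injective (hh.col _ hi)⟩

/-- Deleted rows and columns consist of straight cells and corners, which are r-elbows. -/
theorem Hooked.numTile_jelbow (h : Hooked w s t B) :
    numTile .jelbow (fun i j => B (s i) (t j)) = numTile .jelbow B := by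
  refine Finset.card_bij (fun p _ => (s p.1, t p.2)) ?_ ?_ ?_
  · intro p hp
    simpa using hp
  · intro p _ q _ hpq
    simp only [Prod.mk.injEq, EmbeddingLike.apply_eq_iff_eq] at hpq
    exact Prod.ext hpq.1 hpq.2
  · rintro ⟨i, j⟩ hp
    simp only [Finset.mem_filter, Finset.mem_univ, true_and] at hp
    have hi : i ∈ Set.range s := by
      by_contra hi
      by_cases hj : j = w i
      · rw [hj, (h.hook i hi).relbow] at hp
        cases hp
      · exact ((h.hook i hi).straight_row h.isBPD hj).2 hp
    obtain ⟨i, rfl⟩ := hi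
    have hj : j ∈ Set.range t := by
      by_contra hj
      exact (h.straight_col hj i).2 hp
    obtain ⟨j, rfl⟩ := hj
    exact ⟨(i, j), by simpa using hp, rfl⟩

end

/-! ### A hooked filling is determined by its submatrix -/

section
variable {w : Equiv.Perm (Fin n)} {s t : Fin m ↪o Fin n} {B B' : Tiling n} {D : Tiling m}

theorem transpose_submatrix (s t : Fin m ↪o Fin n) (B : Tiling n) :
    (fun i j => transpose B (t i) (s j)) = transpose fun i j => B (s i) (t j) := rfl

/-- In a kept row the edges are forced from left to right: a kept column reads its edge off the
submatrix, a deleted one copies the edge to its left. In a deleted row the corner decides. -/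
theorem Hooked.hasE_iff (h : Hooked w s t B) (h' : Hooked w s t B')
    (he : (fun i j => B (s i) (t j)) = fun i j => B' (s i) (t j)) (i j : Fin n) :
    (B i j).hasE ↔ (B' i j).hasE := by
  by_cases hi : i ∈ Set.range s
  · obtain ⟨a, rfl⟩ := hi
    induction hk : j.val using Nat.strong_induction_on generalizing j with
    | _ k ih =>
    by_cases hj : j ∈ Set.range t
    · obtain ⟨b, rfl⟩ := hj
      rw [congrFun (congrFun he a) b]
    · rw [(h.straight_col hj a).hasE_iff, (h'.straight_col hj a).hasE_iff]
      by_cases h0 : j.val = 0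
      · exact iff_of_false (h.isBPD.west _ j h0) (h'.isBPD.west _ j h0)
      · obtain ⟨q, hq⟩ : ∃ q : Fin n, j.val = q.val + 1 := ⟨⟨j.val - 1, by omega⟩, by simp; omega⟩
        rw [← h.isBPD.horiz _ q j hq, ← h'.isBPD.horiz _ q j hq]
        exact ih _ (by omega) q rfl
  · have hB := h.hook i hi
    have hB' := h'.hook i hi
    rcases lt_trichotomy j (w i) with hj | rfl | hj
    · exact iff_of_false (hB.row_left h.isBPD hj).1 (hB'.row_left h'.isBPD hj).1
    · rw [hB.relbow, hB'.relbow]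
    · exact iff_of_true (hB.row_right h.isBPD hj).1 (hB'.row_right h'.isBPD hj).1

theorem Hooked.hasW_iff (h : Hooked w s t B) (h' : Hooked w s t B')
    (he : (fun i j => B (s i) (t j)) = fun i j => B' (s i) (t j)) (i j : Fin n) :
    (B i j).hasW ↔ (B' i j).hasW := by
  by_cases h0 : j.val = 0
  · exact iff_of_false (h.isBPD.west _ j h0) (h'.isBPD.west _ j h0)
  · obtain ⟨q, hq⟩ : ∃ q : Fin n, j.val = q.val + 1 := ⟨⟨j.val - 1, by omega⟩, by simp; omega⟩
    rw [← h.isBPD.horiz _ q j hq, ← h'.isBPD.horiz _ q j hq, h.hasE_iff h' he]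

/-- A bumpless pipe dream with hooks is determined by what remains after deleting the hooks. -/
theorem Hooked.eq_of_submatrix_eq (h : Hooked w s t B) (h' : Hooked w s t B')
    (he : (fun i j => B (s i) (t j)) = fun i j => B' (s i) (t j)) : B = B' := by
  have he' : (fun i j => BumplessPipeDream.transpose B (t i) (s j)) =
      fun i j => BumplessPipeDream.transpose B' (t i) (s j) := by
    rw [transpose_submatrix, transpose_submatrix, he]
  funext i j
  refine Tile.ext_edges ?_ ?_ (h.hasE_iff h' he i j) (h.hasW_iff h' he i j)
  · simpa [BumplessPipeDream.transpose] using h.transpose.hasW_iff h'.transpose he' j i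
  · simpa [BumplessPipeDream.transpose] using h.transpose.hasE_iff h'.transpose he' j i

end

/-! ### Inserting hooks -/

open Classical in
/-- The tile with given edges, for edges that fit to a tile. -/
noncomputable def Tile.ofEdges (N S E W : Prop) : Tile :=
  if N then if S then if E then .cross else .vertical else .jelbow
  else if S then .relbow else if E ∧ W then .horizontal else .blank

/-- The edges `N, S, E, W` of a cell belong to a tile. -/
def CompatibleEdges (N S E W : Prop) : Prop :=
  ((N ↔ S) ∧ (E ↔ W)) ∨ (S ∧ ¬ N ∧ E ∧ ¬ W) ∨ (N ∧ ¬ S ∧ W ∧ ¬ E)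

section
variable {N S E W : Prop}

theorem Tile.ofEdges_hasN (h : CompatibleEdges N S E W) : (ofEdges N S E W).hasN ↔ N := by
  by_cases hN : N <;> by_cases hS : S <;> by_cases hE : E <;> by_cases hW : W <;>
    simp_all [CompatibleEdges, ofEdges, hasN]

theorem Tile.ofEdges_hasS (h : CompatibleEdges N S E W) : (ofEdges N S E W).hasS ↔ S := by
  by_cases hN : N <;> by_cases hS : S <;> by_cases hE : E <;> by_cases hW : W <;>
    simp_all [CompatibleEdges, ofEdges, hasS]

theorem Tile.ofEdges_hasE (h : CompatibleEdges N S E W) : (ofEdges N S E W).hasE ↔ E := by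
  by_cases hN : N <;> by_cases hS : S <;> by_cases hE : E <;> by_cases hW : W <;>
    simp_all [CompatibleEdges, ofEdges, hasE]

theorem Tile.ofEdges_hasW (h : CompatibleEdges N S E W) : (ofEdges N S E W).hasW ↔ W := by
  by_cases hN : N <;> by_cases hS : S <;> by_cases hE : E <;> by_cases hW : W <;>
    simp_all [CompatibleEdges, ofEdges, hasW]

end

theorem Tile.compatibleEdges (t : Tile) : CompatibleEdges t.hasN t.hasS t.hasE t.hasW := by
  cases t <;> simp [CompatibleEdges, hasN, hasS, hasE, hasW]

/-- After inserting hooks into `D`, the horizontal edge of row `r` with `k` columns to its left is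
used. -/
def RowEdge (w : Equiv.Perm (Fin n)) (s t : Fin m ↪o Fin n) (D : Tiling m) (k : ℕ) (r : Fin n) :
    Prop :=
  (r ∉ Set.range s ∧ (w r).val < k) ∨
    ∃ a b, s a = r ∧ (t b).val < k ∧ (∀ b', (t b').val < k → b' ≤ b) ∧ (D a b).hasE

/-- After inserting hooks into `D`, the vertical edge of column `c` with `k` rows above it is
used. -/
def ColEdge (w : Equiv.Perm (Fin n)) (s t : Fin m ↪o Fin n) (D : Tiling m) (k : ℕ) (c : Fin n) :
    Prop :=
  RowEdge w.symm t s (transpose D) k c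

/-- Insert into `D` hooks at `(x, w x)` for all `x` not in the range of `s`. -/
noncomputable def insertHooks (w : Equiv.Perm (Fin n)) (s t : Fin m ↪o Fin n) (D : Tiling m) :
    Tiling n := fun i j =>
  -- Lines between cells are numbered by the cells before them: `j` is the west and `j + 1` the east
  -- line of column `j`, and likewise `i` and `i + 1` for north and south.
  Tile.ofEdges (ColEdge w s t D i j) (ColEdge w s t D (i + 1) j)
    (RowEdge w s t D (j + 1) i) (RowEdge w s t D j i)

section
variable {w : Equiv.Perm (Fin n)} {s t : Fin m ↪o Fin n} {B : Tiling n} {D : Tiling m}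

theorem rowEdge_of_not_mem {r : Fin n} (hr : r ∉ Set.range s) (k : ℕ) :
    RowEdge w s t D k r ↔ (w r).val < k := by
  constructor
  · rintro (⟨_, h⟩ | ⟨a, b, rfl, _⟩)
    · exact h
    · exact absurd ⟨a, rfl⟩ hr
  · exact fun h => Or.inl ⟨hr, h⟩

theorem rowEdge_apply {k : ℕ} {a : Fin m} {b : Fin m} (h1 : (t b).val < k)
    (h2 : ∀ b', (t b').val < k → b' ≤ b) : RowEdge w s t D k (s a) ↔ (D a b).hasE := by
  constructor
  · rintro (⟨h, _⟩ | ⟨a', b', h, h3, h4, h5⟩)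
    · exact absurd ⟨a, rfl⟩ h
    · obtain rfl := s.injective h
      obtain rfl := le_antisymm (h2 _ h3) (h4 _ h1)
      exact h5
  · exact fun h => Or.inr ⟨a, b, rfl, h1, h2, h⟩

theorem rowEdge_east (a b : Fin m) :
    RowEdge w s t D ((t b).val + 1) (s a) ↔ (D a b).hasE :=
  rowEdge_apply (by omega) fun b' h => by
    have : t b' ≤ t b := by omega
    exact t.le_iff_le.1 this

theorem rowEdge_west (hD : IsBPD D) (a b : Fin m) :
    RowEdge w s t D (t b).val (s a) ↔ (D a b).hasW := by
  by_cases h0 : b.val = 0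
  · refine iff_of_false ?_ (hD.west a b h0)
    rintro (⟨h, _⟩ | ⟨a', b', h, h3, _⟩)
    · exact absurd ⟨a, rfl⟩ h
    · have := t.lt_iff_lt.1 h3
      omega
  · obtain ⟨q, hq⟩ : ∃ q : Fin m, b.val = q.val + 1 := ⟨⟨b.val - 1, by omega⟩, by simp; omega⟩
    rw [← hD.horiz a q b hq]
    refine rowEdge_apply (t.lt_iff_lt.2 (by omega : q < b)) fun b' h => ?_
    have := t.lt_iff_lt.1 h
    omega

/-- A horizontal edge can change only across a corner or across a cell that comes from `D`. -/
theorem rowEdge_succ {r c : Fin n} (h : r ∈ Set.range s → c ∉ Set.range t) (hc : c ≠ w r) :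
    RowEdge w s t D (c.val + 1) r ↔ RowEdge w s t D c.val r := by
  by_cases hr : r ∈ Set.range s
  · have key : ∀ b, (t b).val < c.val + 1 ↔ (t b).val < c.val := by
      intro b
      have : t b ≠ c := fun h' => h hr ⟨b, h'⟩
      omega
    simp only [RowEdge, key, hr, not_true_eq_false, false_and]
  · rw [rowEdge_of_not_mem hr, rowEdge_of_not_mem hr]
    omega

theorem not_rowEdge_zero (r : Fin n) : ¬ RowEdge w s t D 0 r := by
  rintro (⟨_, h⟩ | ⟨_, _, _, h, _⟩) <;> omega

theorem rowEdge_last (hD : IsBPD D) (r : Fin n) : RowEdge w s t D n r := by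
  by_cases hr : r ∈ Set.range s
  · obtain ⟨a, rfl⟩ := hr
    obtain ⟨b, hb⟩ := exists_last a
    exact (rowEdge_apply (b := b) (by omega) fun b' _ => by omega).2 (hD.east a b hb)
  · exact (rowEdge_of_not_mem hr n).2 (by omega)

theorem rowEdge_succ_of_ne {i j : Fin n}
    (h : ¬ (i ∈ Set.range s ∧ j ∈ Set.range t)) (hj : j ≠ w i) :
    (RowEdge w s t D (j.val + 1) i ↔ RowEdge w s t D j.val i) ∧
      (ColEdge w s t D (i.val + 1) j ↔ ColEdge w s t D i.val j) := by
  refine ⟨rowEdge_succ (fun hi hj => h ⟨hi, hj⟩) hj, rowEdge_succ (fun hj hi => h ⟨hi, hj⟩) ?_⟩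
  rintro rfl
  simp at hj

theorem edges_hook (ht : ∀ x, w x ∈ Set.range t ↔ x ∈ Set.range s) {i : Fin n}
    (hi : i ∉ Set.range s) :
    RowEdge w s t D ((w i).val + 1) i ∧ ¬ RowEdge w s t D (w i).val i ∧
      ColEdge w s t D (i.val + 1) (w i) ∧ ¬ ColEdge w s t D i.val (w i) := by
  have hw : w i ∉ Set.range t := fun h => hi ((ht i).1 h)
  simp only [ColEdge, rowEdge_of_not_mem hi, rowEdge_of_not_mem hw]
  simp

theorem edges_submatrix (hD : IsBPD D) (a b : Fin m) :
    (ColEdge w s t D (s a).val (t b) ↔ (D a b).hasN) ∧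
      (ColEdge w s t D ((s a).val + 1) (t b) ↔ (D a b).hasS) ∧
      (RowEdge w s t D ((t b).val + 1) (s a) ↔ (D a b).hasE) ∧
      (RowEdge w s t D (t b).val (s a) ↔ (D a b).hasW) := by
  refine ⟨?_, ?_, rowEdge_east a b, rowEdge_west hD a b⟩
  · rw [ColEdge, rowEdge_west hD.transpose]
    simp [transpose]
  · rw [ColEdge, rowEdge_east]
    simp [transpose]

/-- There are three kinds of cells: those of `D` keep their edges, the corners become r-elbows, and
all others are straight. -/
theorem compatibleEdges_insertHooks (hD : IsBPD D)
    (ht : ∀ x, w x ∈ Set.range t ↔ x ∈ Set.range s) (i j : Fin n) :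
    CompatibleEdges (ColEdge w s t D i j) (ColEdge w s t D (i + 1) j)
      (RowEdge w s t D (j + 1) i) (RowEdge w s t D j i) := by
  by_cases h : i ∈ Set.range s ∧ j ∈ Set.range t
  · obtain ⟨⟨a, rfl⟩, ⟨b, rfl⟩⟩ := h
    obtain ⟨h1, h2, h3, h4⟩ := edges_submatrix (w := w) (s := s) (t := t) hD a b
    rw [h1, h2, h3, h4]
    exact (D a b).compatibleEdges
  · by_cases hj : j = w i
    · subst hj
      have hi : i ∉ Set.range s := fun hi => h ⟨hi, (ht i).2 hi⟩
      obtain ⟨h1, h2, h3, h4⟩ := edges_hook (D := D) ht hi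
      exact Or.inr (Or.inl ⟨h3, h4, h1, h2⟩)
    · obtain ⟨h1, h2⟩ := rowEdge_succ_of_ne (s := s) (t := t) (D := D) h hj
      exact Or.inl ⟨h2.symm, h1⟩

theorem insertHooks_submatrix (hD : IsBPD D) :
    (fun i j => insertHooks w s t D (s i) (t j)) = D := by
  funext a b
  obtain ⟨h1, h2, h3, h4⟩ := edges_submatrix (w := w) (s := s) (t := t) hD a b
  rw [insertHooks, h1, h2, h3, h4]
  have hc := (D a b).compatibleEdges
  exact Tile.ext_edges (Tile.ofEdges_hasN hc) (Tile.ofEdges_hasS hc) (Tile.ofEdges_hasE hc)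
    (Tile.ofEdges_hasW hc)

theorem insertHooks_isBPD (hD : IsBPD D) (ht : ∀ x, w x ∈ Set.range t ↔ x ∈ Set.range s) :
    IsBPD (insertHooks w s t D) := by
  have hc := compatibleEdges_insertHooks hD ht
  constructor
  · intro i j j' hj
    rw [insertHooks, insertHooks, Tile.ofEdges_hasE (hc i j), Tile.ofEdges_hasW (hc i j'), hj]
  · intro i i' j hi
    rw [insertHooks, insertHooks, Tile.ofEdges_hasS (hc i j), Tile.ofEdges_hasN (hc i' j), hi]
  · intro i j hj
    rw [insertHooks, Tile.ofEdges_hasW (hc i j), hj]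
    exact not_rowEdge_zero i
  · intro i j hi
    rw [insertHooks, Tile.ofEdges_hasN (hc i j), hi]
    exact not_rowEdge_zero j
  · intro i j hj
    rw [insertHooks, Tile.ofEdges_hasE (hc i j), hj]
    exact rowEdge_last hD i
  · intro i j hi
    rw [insertHooks, Tile.ofEdges_hasS (hc i j), hi]
    exact rowEdge_last hD.transpose j

theorem insertHooks_hooked (hD : IsBPD D) (ht : ∀ x, w x ∈ Set.range t ↔ x ∈ Set.range s) :
    Hooked w s t (insertHooks w s t D) := by
  refine ⟨insertHooks_isBPD hD ht, ht, fun x hx => ?_⟩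
  have hc := compatibleEdges_insertHooks hD ht
  constructor
  · obtain ⟨h1, h2, h3, h4⟩ := edges_hook (D := D) ht hx
    simp [insertHooks, Tile.ofEdges, h3, h4]
  · intro j hj
    by_contra hne
    have := (rowEdge_succ_of_ne (s := s) (t := t) (D := D) (fun h => hx h.1) hne).1
    exact (Tile.straight_of_hasE_iff (((Tile.ofEdges_hasE (hc x j)).trans this).trans
      (Tile.ofEdges_hasW (hc x j)).symm)).1 hj
  · intro i hi
    by_contra hne
    have := (rowEdge_succ_of_ne (s := s) (t := t) (D := D) (fun h => hx ((ht x).1 h.2))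
      (w.injective.ne (Ne.symm hne))).1
    exact (Tile.straight_of_hasE_iff (((Tile.ofEdges_hasE (hc i (w x))).trans this).trans
      (Tile.ofEdges_hasW (hc i (w x))).symm)).1 hi

/-- Kept pipes are lifted from the submatrix and the others are the hooks. Reducedness plays no role
here. -/
theorem Hooked.hasPerm (h : Hooked w s t B) {u : Equiv.Perm (Fin m)}
    (hu : ∀ i, t (u i) = w (s i)) (hD : HasPerm u fun i j => B (s i) (t j)) : HasPerm w B := by
  refine ⟨h.isBPD, fun x => ?_⟩
  by_cases hx : x ∈ Set.range s
  · obtain ⟨i, rfl⟩ := hx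
    rw [← hu]
    exact h.isPipe (hD.2 i)
  · exact (h.hook x hx).isPipe h.isBPD

end

/-! ### A j-elbow south-east of a cell forces an inversion -/

theorem straight_right {B : Tiling n} (hB : IsBPD B) {r c : Fin n} (hE : (B r c).hasE)
    (hj : ∀ k, c < k → B r k ≠ .jelbow) {k : Fin n} (hk : c < k) : (B r k).Straight := by
  -- Going right, a used horizontal edge can stop only at a j-elbow, so it stays used all the way.
  suffices h : (B r k).hasW from
    Tile.straight_of_hasE_iff (by
      have := hj k hk
      generalize B r k = t at *
      cases t <;> simp_all [Tile.hasE, Tile.hasW])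
  induction hd : k.val - c.val generalizing k with
  | zero => omega
  | succ d ih =>
    obtain ⟨q, hq⟩ : ∃ q : Fin n, k.val = q.val + 1 := ⟨⟨k.val - 1, by omega⟩, by simp; omega⟩
    refine (hB.horiz r q k hq).1 ?_
    by_cases hqc : q = c
    · rwa [hqc]
    · have h1 := ih (k := q) (by omega) (by omega)
      have h2 := hj q (by omega)
      generalize B r q = t at *
      cases t <;> simp_all [Tile.hasE, Tile.hasW]

theorem straight_below {B : Tiling n} (hB : IsBPD B) {r c : Fin n} (hS : (B r c).hasS)
    (hj : ∀ k, r < k → B k c ≠ .jelbow) {k : Fin n} (hk : r < k) : (B k c).Straight := by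
  have := straight_right hB.transpose (r := c) (c := r) (k := k) (by simpa [transpose] using hS)
    (fun k hk => by simpa [transpose] using hj k hk) hk
  simpa [transpose, Tile.Straight] using this

/-- A j-elbow leaves its east edge unused, while the east side of the grid is used; a new strand has
to begin in between. -/
theorem exists_relbow_right {B : Tiling n} (hB : IsBPD B) {r c : Fin n} (ht : B r c = .jelbow)
    (hj : ∀ k, c < k → B r k ≠ .jelbow) : ∃ k, c < k ∧ B r k = .relbow := by
  by_contra! h
  have := hasE_of_straight hB (r := r) (c := c) fun k hk => ⟨h k hk, hj k hk⟩
  simp [ht, Tile.hasE] at this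

theorem exists_relbow_below {B : Tiling n} (hB : IsBPD B) {r c : Fin n} (ht : B r c = .jelbow)
    (hj : ∀ k, r < k → B k c ≠ .jelbow) : ∃ k, r < k ∧ B k c = .relbow := by
  have := exists_relbow_right hB.transpose (r := c) (c := r) (by simpa [transpose] using ht)
    (fun k hk => by simpa [transpose] using hj k hk)
  simpa [transpose] using this

/-- If no j-elbow lies to the south-east of `(x, y)`, then a pipe that enters a cell there, or a
cell of row `x` to the right of `y`, from below starts in the column of that cell. -/
theorem Enters.eq_col {B : Tiling n} {x y p i j : Fin n} {d : Dir}
    (hno : ∀ i j, x < i → y < j → B i j ≠ .jelbow) (h : Enters B p i j d) (hd : d = .north)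
    (hi : x ≤ i) (hj : y < j) : p = j := by
  induction h with
  | start => rfl
  | straightNorth i i' j h ht hi' ih => exact ih rfl (by omega) hj
  | turnEast => cases hd
  | straightEast => cases hd
  | turnNorth i i' j h ht hi' ih => exact absurd ht (hno i j (by omega) hj)

/-- A j-elbow to the south-east of `(x, y)` gives an inversion among the pipes that start to the
right of `y` and end below `x`. -/
theorem HasPerm.exists_inversion {w : Equiv.Perm (Fin n)} {B : Tiling n} (hB : HasPerm w B)
    {x y i j : Fin n} (hi : x < i) (hj : y < j) (ht : B i j = .jelbow) :
    ∃ c d, x < c ∧ c < d ∧ y < w d ∧ w d < w c := by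
  -- Choosing `i + j` maximal leaves no other j-elbow weakly to the south-east of the chosen one.
  obtain ⟨p, hp, hmax⟩ := Finset.exists_max_image
    (Finset.univ.filter fun p : Fin n × Fin n => x < p.1 ∧ y < p.2 ∧ B p.1 p.2 = .jelbow)
    (fun p => p.1.val + p.2.val) ⟨(i, j), by simp [hi, hj, ht]⟩
  obtain ⟨i, j⟩ := p
  simp only [Finset.mem_filter, Finset.mem_univ, true_and, Prod.forall] at hp hmax
  obtain ⟨hi, hj, ht⟩ := hp
  have hno : ∀ a b, i ≤ a → j ≤ b → i.val + j.val < a.val + b.val → B a b ≠ .jelbow :=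
    fun a b h1 h2 h3 h4 => by
      have := hmax a b ⟨by omega, by omega, h4⟩
      omega
  obtain ⟨j₁, hj₁, ht₁⟩ := exists_relbow_right hB.1 ht fun k hk => hno i k le_rfl hk.le (by omega)
  obtain ⟨i₁, hi₁, ht₂⟩ := exists_relbow_below hB.1 ht fun k hk => hno k j hk.le le_rfl (by omega)
  -- Without j-elbows in this region, an r-elbow's pipe is straight both below it and to its right,
  -- so it starts and ends at the elbow's column and row.
  have hpipe : ∀ a b, i ≤ a → j ≤ b → i.val + j.val < a.val + b.val → B a b = .relbow →
      w a = b := by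
    intro a b h1 h2 h3 h4
    refine (hB.eq_of_isPipe (isPipe_of_straight_right hB.1
      (enters_of_straight_below hB.1 fun k hk => ?_) h4 fun k hk => ?_)).symm
    · exact straight_below hB.1 (by simp [h4, Tile.hasS])
        (fun l hl => hno l b (by omega) h2 (by omega)) hk
    · exact straight_right hB.1 (by simp [h4, Tile.hasE])
        (fun l hl => hno a l h1 (by omega) (by omega)) hk
  refine ⟨i, i₁, hi, hi₁, ?_, ?_⟩
  · rw [hpipe i₁ j hi₁.le le_rfl (by omega) ht₂]; exact hj
  · rw [hpipe i₁ j hi₁.le le_rfl (by omega) ht₂, hpipe i j₁ le_rfl hj₁.le (by omega) ht₁]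
    exact hj₁

/-! ### Reducedness after insertion, from avoidance of `1243` -/

section
variable {w : Equiv.Perm (Fin n)} {s t : Fin m ↪o Fin n} {B : Tiling n}

/-- The pipe starts to the left of column `w x` and ends above row `x`. If no j-elbow lay south-east
of `(x, w x)`, a pipe going up through `(x, j)` would have started in column `j`, to the right of `w
x`. So there is such a j-elbow, and the inversion that it forces completes `x'`, `x` to a `1243`
pattern. -/
theorem HasPerm.not_enters_twice (hB : HasPerm w B) (hw : Avoids1243 w) {x x' i j : Fin n}
    (hne : x' ≠ x) (h : Enters B (w x') i (w x) .east) (h' : Enters B (w x') x j .north) (hj : w x < j) : False := by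
  have h1 : w x' < w x := h.col_le.2 rfl
  have h2 : x' < x := lt_of_le_of_ne (hB.le_of_enters h') hne
  obtain ⟨i₀, j₀, hi₀, hj₀, ht⟩ : ∃ i j, x < i ∧ w x < j ∧ B i j = .jelbow := by
    by_contra! hno
    have := h'.eq_col hno rfl le_rfl hj
    omega
  obtain ⟨c, d, hc, hcd, hd, hdc⟩ := hB.exists_inversion hi₀ hj₀ ht
  exact hw ⟨x', x, c, d, h2, hc, hcd, h1, hd, hdc⟩

theorem CrossAt.symm {y y' i j : Fin n} (h : CrossAt B y y' i j) : CrossAt B y' y i j :=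
  ⟨h.1, h.2.elim (fun h => Or.inr ⟨h.2, h.1⟩) fun h => Or.inl ⟨h.2, h.1⟩⟩

theorem IsHook.crossAt {x y y' i j : Fin n} (hB : IsBPD B) (hx : IsHook B x y)
    (h : CrossAt B y y' i j) : (j = y ∧ x < i ∧ Enters B y' i y .east) ∨
      (i = x ∧ y < j ∧ Enters B y' x j .north) := by
  obtain ⟨ht, ⟨h1, h2⟩ | ⟨h1, h2⟩⟩ := h
  · obtain ⟨_, rfl, h3⟩ | ⟨h3, _⟩ := hx.of_enters hB h1
    · refine Or.inl ⟨rfl, lt_of_le_of_ne h3 ?_, h2⟩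
      rintro rfl
      simp [hx.relbow] at ht
    · cases h3
  · obtain ⟨h3, _⟩ | ⟨_, rfl, h3⟩ := hx.of_enters hB h1
    · cases h3
    · exact Or.inr ⟨rfl, h3, h2⟩

/-- If `w` avoids `1243`, then a hook crosses any other pipe at most once. -/
theorem IsHook.cross_once (hB : HasPerm w B) (hw : Avoids1243 w) {x x' : Fin n}
    (hx : IsHook B x (w x)) (hne : x' ≠ x) {i j i' j' : Fin n}
    (h : CrossAt B (w x) (w x') i j) (h' : CrossAt B (w x) (w x') i' j') : i = i' ∧ j = j' := by
  obtain ⟨rfl, h1, h2⟩ | ⟨rfl, h1, h2⟩ := hx.crossAt hB.1 h <;>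
    obtain ⟨rfl, h3, h4⟩ | ⟨rfl, h3, h4⟩ := hx.crossAt hB.1 h'
  · exact ⟨h2.row_unique h4, rfl⟩
  · exact (hB.not_enters_twice hw hne h2 h4 h3).elim
  · exact (hB.not_enters_twice hw hne h4 h2 h1).elim
  · exact ⟨rfl, h2.col_unique h4⟩

theorem IsHook.enters_north (hB : IsBPD B) {x y i : Fin n} (hx : IsHook B x y) (hi : x ≤ i) :
    Enters B y i y .north :=
  enters_of_straight_below hB fun _ hk => hx.straight_col hB (by omega)

theorem IsHook.enters_east (hB : IsBPD B) {x y j : Fin n} (hx : IsHook B x y) (hj : y < j) :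
    Enters B y x j .east := by
  obtain ⟨q, hq⟩ : ∃ q : Fin n, q.val = y.val + 1 := ⟨⟨y.val + 1, by omega⟩, rfl⟩
  exact (Enters.turnEast _ _ q (hx.enters_north hB le_rfl) hx.relbow hq).pass_east hB (by omega)
    fun k h1 _ => hx.straight_row hB (by omega)

/-- Two pipes that do not belong to hooks cross in a cell of the submatrix. -/
theorem Hooked.crossAt_mem (h : Hooked w s t B) {a b : Fin m} {i j : Fin n}
    (hc : CrossAt B (t a) (t b) i j) : i ∈ Set.range s ∧ j ∈ Set.range t := by
  have hW : (B i j).hasW := by simp [hc.1, Tile.hasW]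
  have hN : (B i j).hasN := by simp [hc.1, Tile.hasN]
  constructor
  · by_contra hi
    have hx := h.hook i hi
    have hwi : w i ∉ Set.range t := fun hwi => hi ((h.range i).1 hwi)
    have hj : w i < j := by
      rcases lt_trichotomy j (w i) with hj | rfl | hj
      · exact absurd hW (hx.row_left h.isBPD hj).2
      · simp [hx.relbow, Tile.hasW] at hW
      · exact hj
    have he := hx.enters_east h.isBPD hj
    rcases hc.2 with ⟨_, h2⟩ | ⟨h2, _⟩ <;> exact hwi ⟨_, h2.unique he⟩
  · by_contra hj
    obtain ⟨x, hx, rfl⟩ := h.exists_col hj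
    have hx := h.hook x hx
    have hi : x ≤ i := by
      by_contra hi
      exact absurd hN (hx.col_above h.isBPD (by omega)).2
    have he := hx.enters_north h.isBPD hi
    rcases hc.2 with ⟨h2, _⟩ | ⟨_, h2⟩ <;> exact hj ⟨_, h2.unique he⟩

/-- Two kept pipes cross only in cells of the submatrix, which is reduced. If one of the pipes is a
hook, whatever the other is, `IsHook.cross_once` applies. -/
theorem Hooked.reduced (h : Hooked w s t B) (hB : HasPerm w B) (hw : Avoids1243 w)
    (hr : Reduced fun i j => B (s i) (t j)) : Reduced B := by
  intro y y' hy i j i' j' hc hc'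
  obtain ⟨x, rfl⟩ := w.surjective y
  obtain ⟨x', rfl⟩ := w.surjective y'
  have hne : x ≠ x' := fun h => hy (h ▸ rfl)
  by_cases hx : x ∈ Set.range s
  · by_cases hx' : x' ∈ Set.range s
    · obtain ⟨a, ha⟩ := (h.range x).2 hx
      obtain ⟨b, hb⟩ := (h.range x').2 hx'
      rw [← ha, ← hb] at hc hc' hy
      obtain ⟨⟨i, rfl⟩, ⟨j, rfl⟩⟩ := h.crossAt_mem hc
      obtain ⟨⟨i', rfl⟩, ⟨j', rfl⟩⟩ := h.crossAt_mem hc'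
      have := hr a b (fun h => hy (h ▸ rfl)) _ _ _ _ (h.crossAt_iff.2 hc) (h.crossAt_iff.2 hc')
      exact ⟨congrArg s this.1, congrArg t this.2⟩
    · exact (h.hook x' hx').cross_once hB hw hne hc.symm hc'.symm
  · exact (h.hook x hx).cross_once hB hw hne.symm hc hc'

/-! ### The pipe removal map -/

theorem mem_range_sortedEntries (w : Equiv.Perm (Fin n)) (s : Fin m ↪o Fin n) (y : Fin n) :
    y ∈ Set.range (sortedEntries w s) ↔ y ∈ entries w s := by
  rw [sortedEntries, Finset.range_orderEmbOfFin, Finset.mem_coe]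

theorem apply_mem_entries (w : Equiv.Perm (Fin n)) (s : Fin m ↪o Fin n) (x : Fin n) :
    w x ∈ entries w s ↔ x ∈ Set.range s := by
  simp [entries]

theorem apply_mem_range_sortedEntries (w : Equiv.Perm (Fin n)) (s : Fin m ↪o Fin n) (x : Fin n) :
    w x ∈ Set.range (sortedEntries w s) ↔ x ∈ Set.range s := by
  rw [mem_range_sortedEntries, apply_mem_entries]

theorem sortedEntries_stdPerm (w : Equiv.Perm (Fin n)) (s : Fin m ↪o Fin n) (i : Fin m) :
    sortedEntries w s (stdPerm w s i) = w (s i) := sortedEntries_relRank w s i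

theorem mem_bpdSub_iff : B ∈ bpdSub w s ↔
    HasPerm w B ∧ Reduced B ∧ ∀ x, IsHook B x (w x) ↔ x ∉ Set.range s := by
  simp only [bpdSub, Finset.mem_filter, Finset.mem_univ, true_and]
  exact and_congr_right fun h => by simp only [h.1.removable_iff]

theorem mem_mbpd_iff {u : Equiv.Perm (Fin m)} {D : Tiling m} : D ∈ mbpd u ↔
    HasPerm u D ∧ Reduced D ∧ ∀ x, ¬ IsHook D x (u x) := by
  simp only [mbpd, Finset.mem_filter, Finset.mem_univ, true_and]
  refine and_congr_right fun h => and_congr_right fun _ => ?_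
  simp only [Minimal, h.1.removable_iff]
  refine ⟨fun h x => h _ _, fun h' y x hx => ?_⟩
  have := h.eq_of_isPipe (hx.isPipe h.1)
  exact h' x (this ▸ hx)

theorem hooked_of_mem_bpdSub (h : B ∈ bpdSub w s) : Hooked w s (sortedEntries w s) B :=
  have h := mem_bpdSub_iff.1 h
  ⟨h.1.1, apply_mem_range_sortedEntries w s, fun x hx => (h.2.2 x).2 hx⟩

/-- In the remaining rows and columns there is nothing to erase. -/
theorem Hooked.phi_eq (h : Hooked w s (sortedEntries w s) B) :
    phi w s B = fun i j => B (s i) (sortedEntries w s j) := by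
  have key : ∀ i j d, ¬ ∃ y ∈ {y | y ∉ entries w s},
      Enters B y (s i) (sortedEntries w s j) d := by
    rintro i j d ⟨y, hy, he⟩
    rw [Set.mem_ofPred_eq, ← mem_range_sortedEntries] at hy
    obtain ⟨x, hx, rfl⟩ := h.exists_col hy
    rcases (h.hook x hx).of_enters h.isBPD he with ⟨_, h1, _⟩ | ⟨_, h1, _⟩
    · exact hy ⟨j, h1⟩
    · exact hx ⟨i, h1⟩
  have key' : ∀ i j, ¬ ∃ y ∈ {y | y ∉ entries w s}, ∃ d,
      Enters B y (s i) (sortedEntries w s j) d :=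
    fun i j ⟨y, hy, d, he⟩ => key i j d ⟨y, hy, he⟩
  funext i j
  unfold phi erase
  split
  · next ht => rw [if_neg (key i j _), if_neg (key i j _), ht]
  · rw [if_neg (key' i j)]

theorem phi_mem_mbpd (h : B ∈ bpdSub w s) : phi w s B ∈ mbpd (stdPerm w s) := by
  have hh := hooked_of_mem_bpdSub h
  obtain ⟨hB, hr, hx⟩ := mem_bpdSub_iff.1 h
  rw [hh.phi_eq, mem_mbpd_iff]
  refine ⟨hh.hasPerm_submatrix hB (sortedEntries_stdPerm w s), hh.reduced_submatrix hr, ?_⟩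
  intro i hi
  rw [hh.isHook_submatrix_iff, sortedEntries_stdPerm] at hi
  exact (hx _).1 hi ⟨i, rfl⟩

/-- The preimage is `D` with the hooks inserted. Since `D` is minimal, no kept pipe becomes a hook,
so the removable pipes are exactly the inserted ones. -/
theorem exists_phi_eq (hw : Avoids1243 w) {D : Tiling m} (hD : D ∈ mbpd (stdPerm w s)) :
    ∃ B ∈ bpdSub w s, phi w s B = D := by
  obtain ⟨hu, hr, hmin⟩ := mem_mbpd_iff.1 hD
  have hh := insertHooks_hooked hu.1 (apply_mem_range_sortedEntries w s)
  have hsub := insertHooks_submatrix (w := w) (s := s) (t := sortedEntries w s) hu.1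
  rw [← hsub] at hu hr hmin
  have hB := hh.hasPerm (sortedEntries_stdPerm w s) hu
  refine ⟨_, mem_bpdSub_iff.2 ⟨hB, hh.reduced hB hw hr, fun x => ⟨?_, hh.hook x⟩⟩,
    hh.phi_eq.trans hsub⟩
  rintro hx ⟨i, rfl⟩
  rw [← sortedEntries_stdPerm] at hx
  exact hmin i (hh.isHook_submatrix_iff.2 hx)

theorem wt_phi {R : Type*} [CommRing R] (β : R) (h : B ∈ bpdSub w s) :
    wt β B = (1 + β) ^ numTile .jelbow B ∧
      wt β (phi w s B) = (1 + β) ^ numTile .jelbow (phi w s B) ∧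
      wt β B = wt β (phi w s B) := by
  have hB := mem_bpdSub_iff.1 h
  have hD := mem_mbpd_iff.1 (phi_mem_mbpd h)
  have hh := hooked_of_mem_bpdSub h
  refine ⟨hB.1.wt_eq β hB.2.1, hD.1.wt_eq β hD.2.1, ?_⟩
  rw [hB.1.wt_eq β hB.2.1, hD.1.wt_eq β hD.2.1, hh.phi_eq, hh.numTile_jelbow]

end

end BumplessPipeDream

theorem mainTheorem9 {R : Type*} [CommRing R] (β : R) {n m : ℕ}
    (w : Equiv.Perm (Fin n)) (s : Fin m ↪o Fin n) :
    (∀ B ∈ BumplessPipeDream.bpdSub w s,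
      BumplessPipeDream.phi w s B ∈ BumplessPipeDream.mbpd (BumplessPipeDream.stdPerm w s) ∧
      BumplessPipeDream.wt β B = (1 + β) ^ BumplessPipeDream.numTile .jelbow B ∧
      BumplessPipeDream.wt β (BumplessPipeDream.phi w s B) =
        (1 + β) ^ BumplessPipeDream.numTile .jelbow (BumplessPipeDream.phi w s B) ∧
      BumplessPipeDream.wt β B = BumplessPipeDream.wt β (BumplessPipeDream.phi w s B)) ∧
    (BumplessPipeDream.Avoids1243 w →
      BumplessPipeDream.wtSum β (BumplessPipeDream.bpdSub w s) =
        BumplessPipeDream.wtSum β (BumplessPipeDream.mbpd (BumplessPipeDream.stdPerm w s))) := by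
  refine ⟨fun B hB => ⟨BumplessPipeDream.phi_mem_mbpd hB, BumplessPipeDream.wt_phi β hB⟩,
    fun hw => ?_⟩
  -- The map `phi` is a weight-preserving bijection; avoidance of `1243` enters only in
  -- surjectivity.
  refine Finset.sum_nbij (BumplessPipeDream.phi w s)
    (fun B hB => BumplessPipeDream.phi_mem_mbpd hB) ?_ ?_
    (fun B hB => (BumplessPipeDream.wt_phi β hB).2.2)
  · intro B hB B' hB' he
    have h := BumplessPipeDream.hooked_of_mem_bpdSub hB
    have h' := BumplessPipeDream.hooked_of_mem_bpdSub hB'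
    rw [h.phi_eq, h'.phi_eq] at he
    exact h.eq_of_submatrix_eq h' he
  · intro D hD
    exact BumplessPipeDream.exists_phi_eq hw hD
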